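/- Let $(\theta_j)_{j\ge1}$, $(\kappa_j)_{j\ge1}$ be sequences of non-negative reals and, for $N\in\mathbb N$, let $\mathbb P_N$ be the surrogate-spatial measure on the symmetric group $\mathfrak S_N$, $$\mathbb P_N(\sigma)=\frac1{N!\,H_N}\prod_{j=1}^N(\theta_j+N\kappa_j)^{C_j(\sigma)},\qquad H_N=\frac1{N!}\sum_{\sigma\in\mathfrak S_N}\prod_{j=1}^N(\theta_j+N\kappa_j)^{C_j(\sigma)},$$ where $C_j(\sigma)$ is the number of cycles of length $j$ in $\sigma$. Assume that $\kappa$ is non-arithmetic (there is no integer $j_0>1$ dividing every $j$ with $\kappa_j\neq0$) and that $\kappa_j>0$ for some $j\ge2$. Put $g_\theta(z)=\sum_{j\ge1}\frac{\theta_j}{j}z^j$, $g_\kappa(z)=\sum_{j\ge1}\frac{\kappa_j}{j}z^j$, and for a function $g$ write $g^{\{n\}}(z)=z^n\frac{d^n g}{dz^n}(z)$, and $g^{\{n\}}(R)=\lim_{r\uparrow R}g^{\{n\}}(r)\in(-\infty,\infty]$. Assume that $g_\kappa$ has radius of convergence $R\in(0,\infty)$ and that, for some $\eta>0$ and $\varphi\in(0,\pi/2)$,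 both $g_\theta$ and $g_\kappa$ extend holomorphically to $$\Delta_0=\{z\in\mathbb C:\ |z|<R\,|1+\eta e^{i\varphi}|,\ z\ne R,\ |\arg(z-R)|>\varphi\},$$ and that $g_\theta$ is moreover regular (extends analytically) at $z=R$. Assume there is a non-integer $s>1$ such that $g_\kappa^{\{n\}}(R)<\infty$ for all integers $0\le n<s$ and $g_\kappa^{\{n\}}(R)=\infty$ for all integers $n>s$, that $g_\kappa^{\{1\}}(R)<1$ (supercritical regime), and that there are a real $a_s\ne0$ and numbers $\delta_n>0$ such that for every integer $n\ge0$, as $z\to R$ with $z\in\Delta_0$, $$g_\kappa^{\{n\}}(z)=\Bigl(\frac zR\Bigr)^n\Bigl\{\sum_{n\le j<s}\frac{(-1)^{j-n}g_\kappa^{\{j\}}(R)}{(j-n)!}\Bigl(1-\frac zR\Bigr)^{j-n}+\frac{\Gamma(n-s)\,a_s}{\Gamma(-s)}\Bigl(1-\frac zR\Bigr)^{s-n}\Bigr\}+O\Bigl(\Bigl|1-\frac zR\Bigr|^{s-n+\delta_n}\Bigr).$$ Then $H_N>0$ for all sufficiently large $N$, so that $\mathbb P_N$ is well defined. The asymptotic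 expected fraction of points in infinitely long cycles, $\tilde\nu=\lim_{K\to\infty}\liminf_{N\to\infty}\frac1N\mathbb E_N\bigl[\sum_{j>K}jC_j\bigr]$, exists and equals $1-g_\kappa^{\{1\}}(R)>0$. Let $L^{(1)}\ge L^{(2)}\ge\cdots$ be the cycle lengths of $\sigma$ in descending order, with $L^{(k)}=0$ if $\sigma$ has fewer than $k$ cycles. Then, under $\mathbb P_N$, as $N\to\infty$, $$\frac1{N\tilde\nu}\bigl(L^{(1)},L^{(2)},\dots\bigr)\xrightarrow{d}(1,0,0,\dots)$$ in the sense of weak convergence of all finite-dimensional distributions; and in particular $L^{(1)}/(N\tilde\nu)\to1$ in probability. -/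

import Mathlib

open Filter Topology Asymptotics

namespace SurrogateSpatial

/-! ## Cycle counts and ordered cycle lengths -/

/-- `C_j(σ)`: the number of cycles of length `j` of `σ`; fixed points are cycles of length `1`. -/
def cycleCount {N : ℕ} (σ : Equiv.Perm (Fin N)) (j : ℕ) : ℕ :=
  σ.partition.parts.count j

/-- The length of the `(k + 1)`-st longest cycle of `σ` (so `k = 0` is the longest cycle);
it is `0` if `σ` has at most `k` cycles. -/
def longestCycle {N : ℕ} (σ : Equiv.Perm (Fin N)) (k : ℕ) : ℕ :=
  (σ.partition.parts.sort (· ≥ ·)).getD k 0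

/-! ## The surrogate-spatial measure -/

/-- The weight `∏_{j=1}^N (θ_j + N κ_j)^{C_j(σ)}`. -/
noncomputable def weight (θ κ : ℕ → ℝ) (N : ℕ) (σ : Equiv.Perm (Fin N)) : ℝ :=
  ∏ j ∈ Finset.Icc 1 N, (θ j + N * κ j) ^ cycleCount σ j

/-- The normalization `H_N = (1 / N!) ∑_σ ∏_j (θ_j + N κ_j)^{C_j(σ)}`. -/
noncomputable def normConst (θ κ : ℕ → ℝ) (N : ℕ) : ℝ :=
  (1 / (N.factorial : ℝ)) * ∑ σ : Equiv.Perm (Fin N), weight θ κ N σ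

/-- The point probabilities of the surrogate-spatial measure on the symmetric group
(a probability measure as soon as `H_N > 0`). -/
noncomputable def pointProb (θ κ : ℕ → ℝ) (N : ℕ) (σ : Equiv.Perm (Fin N)) : ℝ :=
  (1 / ((N.factorial : ℝ) * normConst θ κ N)) * weight θ κ N σ

/-- Probability of an event under the surrogate-spatial measure. -/
noncomputable def prob (θ κ : ℕ → ℝ) (N : ℕ) (A : Set (Equiv.Perm (Fin N))) : ℝ :=
  ∑ σ : Equiv.Perm (Fin N), A.indicator (pointProb θ κ N) σ

/-- Expectation under the surrogate-spatial measure. -/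
noncomputable def expect (θ κ : ℕ → ℝ) (N : ℕ) (F : Equiv.Perm (Fin N) → ℝ) : ℝ :=
  ∑ σ : Equiv.Perm (Fin N), pointProb θ κ N σ * F σ

/-- `ν̃_K = liminf_N (1/N) E_N [∑_{j>K} j C_j]`: the asymptotic expected fraction of points in
cycles longer than `K`. -/
noncomputable def nuTildeK (θ κ : ℕ → ℝ) (K : ℕ) : ℝ :=
  liminf (fun N : ℕ => (1 / (N : ℝ)) *
    expect θ κ N (fun σ => ∑ j ∈ Finset.Ioc K N, (j : ℝ) * (cycleCount σ j : ℝ))) atTop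

/-- `ν̃ = lim_K ν̃_K`: the asymptotic expected fraction of points in infinitely long cycles. -/
noncomputable def nuTilde (θ κ : ℕ → ℝ) : ℝ :=
  limUnder atTop (nuTildeK θ κ)

/-! ## Generating functions -/

/-- The power series `∑_{j ≥ 1} (a_j / j) z^j` (the term of index `0` is `a 0 / 0 = 0`). -/
noncomputable def genSeries (a : ℕ → ℝ) : FormalMultilinearSeries ℂ ℂ ℂ :=
  FormalMultilinearSeries.ofScalars ℂ (fun j : ℕ => ((a j / j : ℝ) : ℂ))

/-- `g` is a holomorphic function in the domain `U` (a connected open neighbourhood of `0` in all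
uses) whose expansion at `0` is `∑_{j ≥ 1} (a_j / j) z^j`. -/
def IsGenFunOn (a : ℕ → ℝ) (g : ℂ → ℂ) (U : Set ℂ) : Prop :=
  HasFPowerSeriesAt g (genSeries a) 0 ∧ DifferentiableOn ℂ g U

/-- The modified derivative `g^{n}(z) = z^n (d/dz)^n g(z)`. -/
noncomputable def modDeriv (n : ℕ) (g : ℂ → ℂ) (z : ℂ) : ℂ :=
  z ^ n * iteratedDeriv n g z

/-- The domain `Δ₀(R, η, φ)`: a disk of radius `|R (1 + η e^{iφ})|` without the closed sector with
vertex `R` and half-angle `φ` about the ray `[R, ∞)`. -/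
def Delta0 (R η φ : ℝ) : Set ℂ :=
  {z : ℂ | ‖z‖ < ‖(R : ℂ) * (1 + η * Complex.exp (Complex.I * φ))‖ ∧ z ≠ (R : ℂ) ∧
    φ < |Complex.arg (z - (R : ℂ))|}

/-- The principal part, as `z → R`, of the expansion of `g^{n}(z)`, for a function `g` with boundary
values `c j = g^{j}(R)` (`j < s`) and a singular term `a (1 - z/R)^s`:
`(z/R)^n { ∑_{n ≤ j < s} (-1)^{j-n} c_j / (j-n)! (1 - z/R)^{j-n}
  + Γ(n-s) / Γ(-s) a (1 - z/R)^{s-n} }`. -/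
noncomputable def singularExpansion (R s a : ℝ) (c : ℕ → ℝ) (n : ℕ) (z : ℂ) : ℂ :=
  (z / R) ^ n *
    ((∑ j ∈ Finset.Ico n ⌈s⌉₊,
        (((-1) ^ (j - n) * c j / ((j - n).factorial : ℝ) : ℝ) : ℂ) * (1 - z / R) ^ (j - n))
      + ((Real.Gamma (n - s) * a / Real.Gamma (-s) : ℝ) : ℂ) *
        (1 - z / R) ^ (((s - n : ℝ)) : ℂ))

end SurrogateSpatial

namespace SurrogateSpatial

/-! ## Weighted sums over partitions -/

/-! Grouping permutations by cycle type turns the measure into a weight on partitions of N. With x_j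
= (θ_j + N κ_j) R^j / j, a partition with multiplicities m_j has weight ∏ x_j^{m_j} / m_j!, which up
to a constant is the law of independent Poisson(x_j) multiplicities conditioned on total size N.
Thus `partSum x N` is the coefficient of z^N in exp(∑ x_j z^j), and H_N = `partSum x N` / R^N.

The singular expansion gives p_j = κ_j R^j / j ∼ A j^{-s-1} with A = a / Γ(-s) > 0. The numbers θ_j
R^j / j decay faster than any power, and ∑ j p_j = μ = g_κ^{1}(R) < 1. Without conditioning, the
total size concentrates near μN and misses N by (1-μ)N. Because the tails are polynomial, the
cheapest correction is one part of size about (1-μ)N, of intensity about A (1-μ)^{-s-1} N^{-s},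
while the other parts behave as if unconditioned. Hence, with T the total mass, `partSum` at N - k
is asymptotic to A (1-μ)^{-s-1} N^{-s} T for each fixed k (`tendsto_partSum_sub_div`). The upper
bound (`partSum_sub_le`) excludes partitions without a part of order N by a Chernoff bound with tilt
C log N / N, and those whose large part is too small by concentration of the remainder. The lower
bound (`le_sum_window`) counts partitions with exactly one big part.

The conclusions follow from this. H_N is eventually positive. Since shifting by k does not change
the asymptotics, the Mecke formula gives E[j C_j] / N → j p_j, so the mass in cycles longer than K
tends to 1 - ∑_{j ≤ K} j p_j, and then to 1 - μ as K → ∞. Since the two bounds match, partitions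
with one part near (1-μ)N and all others below bN carry asymptotically all the weight
(`eventually_le_sum_window_div`).

The coefficient asymptotics need no contour outside the closed disk. After enough differentiations
g_κ blows up at R like (1 - z/R)^{-β} with β ≥ 3, up to an error O(|1 - z/R|^{-γ}) with 2 ≤ γ < β. A
Cauchy estimate inside the disk controls the coefficients of such an error. -/

/-- The weight `∏_j x_j^{m_j} / m_j!` of a multiset with multiplicities `m_j`. -/
noncomputable def partWeight (x : ℕ → ℝ) (s : Multiset ℕ) : ℝ :=
  ∏ j ∈ s.toFinset, x j ^ s.count j / (s.count j).factorial

/-- The sum of the weights of the partitions of `n`. -/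
noncomputable def partSum (x : ℕ → ℝ) (n : ℕ) : ℝ :=
  ∑ p : n.Partition, partWeight x p.parts

/-- The sequence `x` cut off at index `B`. -/
def trunc (x : ℕ → ℝ) (B : ℕ) (j : ℕ) : ℝ := if j < B then x j else 0

theorem partWeight_eq_prod {x : ℕ → ℝ} {s : Multiset ℕ} {S : Finset ℕ} (h : s.toFinset ⊆ S) :
    partWeight x s = ∏ j ∈ S, x j ^ s.count j / (s.count j).factorial := by
  refine Finset.prod_subset h fun j _ hj => ?_
  rw [Multiset.mem_toFinset] at hj
  simp [Multiset.count_eq_zero_of_notMem hj]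

theorem partWeight_nonneg {x : ℕ → ℝ} (hx : ∀ j, 0 ≤ x j) (s : Multiset ℕ) :
    0 ≤ partWeight x s :=
  Finset.prod_nonneg fun j _ => div_nonneg (pow_nonneg (hx j) _) (by positivity)

theorem partWeight_congr {x y : ℕ → ℝ} {s : Multiset ℕ} (h : ∀ j ∈ s, x j = y j) :
    partWeight x s = partWeight y s :=
  Finset.prod_congr rfl fun j hj => by rw [h j (Multiset.mem_toFinset.1 hj)]

theorem partSum_nonneg {x : ℕ → ℝ} (hx : ∀ j, 0 ≤ x j) (n : ℕ) : 0 ≤ partSum x n :=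
  Finset.sum_nonneg fun _ _ => partWeight_nonneg hx _

theorem partSum_congr {x y : ℕ → ℝ} {n : ℕ} (h : ∀ j, 1 ≤ j → j ≤ n → x j = y j) :
    partSum x n = partSum y n :=
  Finset.sum_congr rfl fun p _ => partWeight_congr fun j hj =>
    h j (p.parts_pos hj) (p.le_of_mem_parts hj)

theorem partSum_zero (x : ℕ → ℝ) : partSum x 0 = 1 := by
  simp [partSum, partWeight]

theorem partWeight_trunc (x : ℕ → ℝ) (B : ℕ) (s : Multiset ℕ) [Decidable (∀ i ∈ s, i < B)] :
    partWeight (trunc x B) s = if ∀ i ∈ s, i < B then partWeight x s else 0 := by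
  split_ifs with h
  · exact partWeight_congr fun j hj => by simp [trunc, h j hj]
  · push Not at h
    obtain ⟨i, hi, hB⟩ := h
    refine Finset.prod_eq_zero (Multiset.mem_toFinset.2 hi) ?_
    have : s.count i ≠ 0 := Multiset.count_ne_zero.2 hi
    simp [trunc, hB.not_gt, this]

/-- This is m · x^m / m! = x · x^{m-1} / (m-1)! in the factor of index j; the other factors agree.
-/
theorem count_mul_partWeight_cons (x : ℕ → ℝ) (j : ℕ) (t : Multiset ℕ) :
    ((j ::ₘ t).count j : ℝ) * partWeight x (j ::ₘ t) = x j * partWeight x t := by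
  have hj : j ∈ (j ::ₘ t).toFinset := by simp
  rw [partWeight, partWeight_eq_prod (s := t) (S := (j ::ₘ t).toFinset)
    (Multiset.toFinset_subset.2 (Multiset.subset_cons t j)),
    ← Finset.mul_prod_erase _ _ hj, ← Finset.mul_prod_erase _ _ hj]
  have h : ∏ i ∈ (j ::ₘ t).toFinset.erase j,
        x i ^ (j ::ₘ t).count i / ((j ::ₘ t).count i).factorial
      = ∏ i ∈ (j ::ₘ t).toFinset.erase j, x i ^ t.count i / (t.count i).factorial := by
    refine Finset.prod_congr rfl fun i hi => ?_
    rw [Multiset.count_cons_of_ne (Finset.ne_of_mem_erase hi)]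
  rw [h, Multiset.count_cons_self, Nat.factorial_succ, pow_succ]
  have h1 : ((t.count j).factorial : ℝ) ≠ 0 := by positivity
  have h2 : ((t.count j : ℝ) + 1) ≠ 0 := by positivity
  push_cast
  field_simp

/-- The Mecke formula: removing a part of size `j`. -/
theorem sum_count_mul_partWeight (x : ℕ → ℝ) (G : Multiset ℕ → ℝ) {j n : ℕ} (hj : 1 ≤ j)
    (hn : j ≤ n) :
    ∑ p : n.Partition, (p.parts.count j : ℝ) * G (p.parts.erase j) * partWeight x p.parts
      = x j * ∑ p : (n - j).Partition, G p.parts * partWeight x p.parts := by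
  have h0 : ∑ p : n.Partition, (p.parts.count j : ℝ) * G (p.parts.erase j) * partWeight x p.parts
      = ∑ p : {p : n.Partition // j ∈ p.parts},
        (p.1.parts.count j : ℝ) * G (p.1.parts.erase j) * partWeight x p.1.parts := by
    rw [← Finset.sum_subtype (Finset.univ.filter fun p : n.Partition => j ∈ p.parts) (by simp)
      (f := fun p : n.Partition =>
        (p.parts.count j : ℝ) * G (p.parts.erase j) * partWeight x p.parts),
      Finset.sum_filter_of_ne]
    intro p _ hp
    by_contra h
    simp [Multiset.count_eq_zero_of_notMem h] at hp
  rw [h0, Finset.mul_sum]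
  refine Fintype.sum_equiv (Nat.Partition.partitionWithPartEquiv hj hn) _ _ fun p => ?_
  rw [Nat.Partition.partitionWithPartEquiv_apply_parts]
  have h := count_mul_partWeight_cons x j (p.1.parts.erase j)
  rw [Multiset.cons_erase p.2] at h
  linear_combination G (p.1.parts.erase j) * h

theorem sum_count_mul_partWeight_one (x : ℕ → ℝ) {j n : ℕ} (hj : 1 ≤ j) (hn : j ≤ n) :
    ∑ p : n.Partition, (p.parts.count j : ℝ) * partWeight x p.parts
      = x j * partSum x (n - j) := by
  simpa [partSum] using sum_count_mul_partWeight x (fun _ => 1) hj hn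

theorem sum_count_mul_eq {n : ℕ} (p : n.Partition) :
    ∑ j ∈ Finset.Icc 1 n, j * p.parts.count j = n := by
  conv_rhs => rw [← p.parts_sum, Finset.sum_multiset_count]
  rw [Finset.sum_subset (s₁ := p.parts.toFinset) (s₂ := Finset.Icc 1 n)]
  · exact Finset.sum_congr rfl fun j _ => by simp [mul_comm]
  · intro j hj
    rw [Multiset.mem_toFinset] at hj
    exact Finset.mem_Icc.2 ⟨p.parts_pos hj, p.le_of_mem_parts hj⟩
  · intro j _ hj
    rw [Multiset.mem_toFinset] at hj
    simp [Multiset.count_eq_zero_of_notMem hj]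

/-- The Mecke formula summed over j, since the parts add up to n. This is the coefficient form of z
F' = (∑ j x_j z^j) F for F = exp(∑ x_j z^j). -/
theorem natCast_mul_partSum (x : ℕ → ℝ) (n : ℕ) :
    (n : ℝ) * partSum x n = ∑ j ∈ Finset.Icc 1 n, j * x j * partSum x (n - j) := by
  have h : ∀ j ∈ Finset.Icc 1 n, (j : ℝ) * x j * partSum x (n - j)
      = ∑ p : n.Partition, (j : ℝ) * p.parts.count j * partWeight x p.parts := by
    intro j hj
    rw [Finset.mem_Icc] at hj
    rw [mul_assoc, ← sum_count_mul_partWeight_one x hj.1 hj.2, Finset.mul_sum]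
    exact Finset.sum_congr rfl fun _ _ => by ring
  rw [Finset.sum_congr rfl h, Finset.sum_comm, partSum, Finset.mul_sum]
  refine Finset.sum_congr rfl fun p _ => ?_
  rw [← Finset.sum_mul]
  congr 1
  exact_mod_cast (sum_count_mul_eq p).symm

theorem partWeight_scale (x : ℕ → ℝ) (r : ℝ) (s : Multiset ℕ) :
    partWeight (fun j => x j * r ^ j) s = r ^ s.sum * partWeight x s := by
  have h : r ^ s.sum = ∏ j ∈ s.toFinset, (r ^ j) ^ s.count j := by
    rw [Finset.sum_multiset_count, ← Finset.prod_pow_eq_pow_sum]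
    exact Finset.prod_congr rfl fun j _ => by rw [smul_eq_mul, mul_comm, pow_mul]
  rw [h, partWeight, partWeight, ← Finset.prod_mul_distrib]
  exact Finset.prod_congr rfl fun j _ => by rw [mul_pow]; ring

/-- Exponential tilting: every partition of n acquires the same factor r^n. It serves both to
normalise the radius R to 1 and to prove the Chernoff bound. -/
theorem partSum_scale (x : ℕ → ℝ) (r : ℝ) (n : ℕ) :
    partSum (fun j => x j * r ^ j) n = r ^ n * partSum x n := by
  simp only [partSum, partWeight_scale, Finset.mul_sum]
  exact Finset.sum_congr rfl fun p _ => by rw [p.parts_sum]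

/-! ### Partition sums as coefficients of an exponential series -/

/-- The recursion for `partSum`, as a differential equation for the generating series. -/
def IsExpSeries (x : ℕ → ℝ) (F : PowerSeries ℝ) : Prop :=
  PowerSeries.constantCoeff F = 1 ∧
    PowerSeries.X * PowerSeries.derivative ℝ F = PowerSeries.mk (fun j => (j : ℝ) * x j) * F

theorem isExpSeries_iff {x : ℕ → ℝ} {F : PowerSeries ℝ} :
    IsExpSeries x F ↔ PowerSeries.coeff 0 F = 1 ∧ ∀ n : ℕ, (n : ℝ) * PowerSeries.coeff n F
      = ∑ j ∈ Finset.Icc 1 n, j * x j * PowerSeries.coeff (n - j) F := by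
  rw [IsExpSeries, PowerSeries.coeff_zero_eq_constantCoeff_apply, PowerSeries.ext_iff]
  refine and_congr_right fun _ => forall_congr' fun n => ?_
  have h1 : PowerSeries.coeff n (PowerSeries.X * PowerSeries.derivative ℝ F)
      = (n : ℝ) * PowerSeries.coeff n F := by
    cases n with
    | zero => simp
    | succ m =>
      rw [PowerSeries.coeff_succ_X_mul, PowerSeries.coeff_derivative]
      push_cast
      ring
  have h2 : PowerSeries.coeff n (PowerSeries.mk (fun j => (j : ℝ) * x j) * F)
      = ∑ j ∈ Finset.Icc 1 n, j * x j * PowerSeries.coeff (n - j) F := by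
    rw [PowerSeries.coeff_mul, Finset.Nat.sum_antidiagonal_eq_sum_range_succ_mk]
    have h3 : Finset.range n.succ = insert 0 (Finset.Icc 1 n) := by
      ext j
      simp only [Finset.mem_range, Finset.mem_insert, Finset.mem_Icc]
      omega
    rw [h3, Finset.sum_insert (by simp)]
    simp
  rw [h1, h2]

theorem isExpSeries_partSum (x : ℕ → ℝ) : IsExpSeries x (PowerSeries.mk (partSum x)) :=
  isExpSeries_iff.2 ⟨by simp [partSum_zero], fun n => by simpa using natCast_mul_partSum x n⟩

/-- The recursion together with the constant term determines all coefficients, because n is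
invertible for n ≥ 1. -/
theorem IsExpSeries.coeff_eq_partSum {x : ℕ → ℝ} {F : PowerSeries ℝ} (h : IsExpSeries x F)
    (n : ℕ) : PowerSeries.coeff n F = partSum x n := by
  induction n using Nat.strong_induction_on with
  | _ n ih =>
    rcases Nat.eq_zero_or_pos n with rfl | hn
    · rw [partSum_zero, (isExpSeries_iff.1 h).1]
    · have hn' : (n : ℝ) ≠ 0 := by positivity
      refine mul_left_cancel₀ hn' ?_
      rw [(isExpSeries_iff.1 h).2, natCast_mul_partSum]
      refine Finset.sum_congr rfl fun j hj => ?_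
      rw [Finset.mem_Icc] at hj
      rw [ih (n - j) (by omega)]

theorem IsExpSeries.mul {x y : ℕ → ℝ} {F G : PowerSeries ℝ} (hF : IsExpSeries x F)
    (hG : IsExpSeries y G) : IsExpSeries (fun j => x j + y j) (F * G) := by
  refine ⟨by rw [map_mul, hF.1, hG.1, one_mul], ?_⟩
  have h : PowerSeries.mk (fun j : ℕ => (j : ℝ) * (x j + y j))
      = PowerSeries.mk (fun j : ℕ => (j : ℝ) * x j) + PowerSeries.mk (fun j => (j : ℝ) * y j) := by
    ext n
    simp [mul_add]
  rw [h, Derivation.leibniz, smul_eq_mul, smul_eq_mul]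
  linear_combination G * hF.2 + F * hG.2

/-- The identity exp(f + g) = exp f · exp g, read off coefficientwise; the Leibniz rule supplies it
through `IsExpSeries.mul`. -/
theorem partSum_add (x y : ℕ → ℝ) (n : ℕ) :
    partSum (fun j => x j + y j) n
      = ∑ k ∈ Finset.range (n + 1), partSum x k * partSum y (n - k) := by
  rw [← ((isExpSeries_partSum x).mul (isExpSeries_partSum y)).coeff_eq_partSum n,
    PowerSeries.coeff_mul, Finset.Nat.sum_antidiagonal_eq_sum_range_succ_mk]
  simp

theorem partSum_single {k : ℕ} (hk : 1 ≤ k) (c : ℝ) (n : ℕ) :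
    partSum (fun j => if j = k then c else 0) n
      = if k ∣ n then c ^ (n / k) / (n / k).factorial else 0 := by
  suffices h : IsExpSeries (fun j => if j = k then c else 0)
      (PowerSeries.mk fun n => if k ∣ n then c ^ (n / k) / (n / k).factorial else 0) by
    rw [← h.coeff_eq_partSum, PowerSeries.coeff_mk]
  refine isExpSeries_iff.2 ⟨by simp, fun n => ?_⟩
  simp only [PowerSeries.coeff_mk]
  by_cases hkn : k ≤ n
  · rw [Finset.sum_eq_single_of_mem k (Finset.mem_Icc.2 ⟨hk, hkn⟩)
      (fun j _ hj => by simp [hj])]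
    by_cases hd : k ∣ n
    · obtain ⟨m, rfl⟩ := hd
      obtain ⟨m, rfl⟩ : ∃ l, m = l + 1 := Nat.exists_eq_succ_of_ne_zero (by
        rintro rfl
        omega)
      have h1 : k * (m + 1) - k = k * m := by rw [mul_add, mul_one, Nat.add_sub_cancel]
      rw [h1, if_pos (dvd_mul_right _ _), if_pos rfl, if_pos (dvd_mul_right _ _),
        Nat.mul_div_cancel_left _ hk, Nat.mul_div_cancel_left _ hk, Nat.factorial_succ]
      have h2 : (m.factorial : ℝ) ≠ 0 := by positivity
      push_cast
      field_simp
      ring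
    · rw [if_neg hd, if_neg (c := k ∣ n - k) (fun h => hd (by
        have := Nat.dvd_add h (dvd_refl k)
        rwa [Nat.sub_add_cancel hkn] at this))]
      simp
  · rw [Finset.sum_eq_zero fun j hj => by
      have : j ≠ k := by rw [Finset.mem_Icc] at hj; omega
      simp [this]]
    rcases Nat.eq_zero_or_pos n with rfl | hn
    · simp
    · rw [if_neg (fun h => hkn (Nat.le_of_dvd hn h)), mul_zero]

theorem hasSum_partSum_single {k : ℕ} (hk : 1 ≤ k) (c : ℝ) :
    HasSum (partSum fun j => if j = k then c else 0) (Real.exp c) := by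
  have h : HasSum (fun m : ℕ => c ^ m / m.factorial) (Real.exp c) := by
    rw [Real.exp_eq_exp_ℝ]
    exact NormedSpace.expSeries_div_hasSum_exp c
  have hinj : Function.Injective fun m : ℕ => k * m := fun a b hab => by
    simpa [show k ≠ 0 by omega] using hab
  rw [← hinj.hasSum_iff]
  · convert h using 2 with m
    simp only [Function.comp_apply]
    rw [partSum_single hk, if_pos (dvd_mul_right _ _), Nat.mul_div_cancel_left _ hk]
  · intro n hn
    rw [partSum_single hk, if_neg]
    rintro ⟨m, rfl⟩
    exact hn ⟨m, rfl⟩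

/-- The total mass of the partition sums of a sequence cut off at `B`. -/
theorem hasSum_partSum_trunc {x : ℕ → ℝ} (hx : ∀ j, 0 ≤ x j) (B : ℕ) :
    HasSum (partSum (trunc x B)) (Real.exp (∑ j ∈ Finset.Ico 1 B, x j)) := by
  induction B with
  | zero =>
    have h : partSum (trunc x 0) = partSum fun j => if j = 1 then 0 else 0 := by
      funext n
      exact partSum_congr fun j _ _ => by simp [trunc]
    rw [h]
    simpa using hasSum_partSum_single le_rfl 0
  | succ B ih =>
    rcases Nat.eq_zero_or_pos B with rfl | hB
    · have h : partSum (trunc x 1) = partSum (trunc x 0) := by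
        funext n
        exact partSum_congr fun j h1 _ => by simp [trunc, show j ≠ 0 by omega]
      rw [zero_add, h]
      simpa using ih
    -- Admitting the part size B convolves the sums with those of a single Poisson variable, so the
    -- total masses multiply (Cauchy product of nonnegative series).
    · have h1 : trunc x (B + 1) = fun j => trunc x B j + if j = B then x B else 0 := by
        funext j
        simp only [trunc]
        rcases lt_trichotomy j B with h | rfl | h
        · simp [h, h.ne, h.trans (Nat.lt_succ_self B)]
        · simp
        · simp [h.ne', h.not_gt, show ¬ j < B + 1 by omega]
      have hs := hasSum_partSum_single hB (x B)
      have ht : ∀ j, 0 ≤ trunc x B j := fun j => by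
        unfold trunc; split_ifs <;> simp [hx]
      have hc : ∀ j, 0 ≤ if j = B then x B else 0 := fun j => by split_ifs <;> simp [hx]
      rw [Finset.sum_Ico_succ_top hB, Real.exp_add, h1]
      have hp := hasSum_sum_range_mul_of_summable_norm (f := partSum (trunc x B))
        (g := partSum fun j => if j = B then x B else 0)
        (ih.summable.congr fun n => (Real.norm_of_nonneg (partSum_nonneg ht n)).symm)
        (hs.summable.congr fun n => (Real.norm_of_nonneg (partSum_nonneg hc n)).symm)
      rw [ih.tsum_eq, hs.tsum_eq] at hp
      rwa [← funext (partSum_add (trunc x B) fun j => if j = B then x B else 0)] at hp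

theorem trunc_nonneg {x : ℕ → ℝ} (hx : ∀ j, 0 ≤ x j) (B j : ℕ) : 0 ≤ trunc x B j := by
  unfold trunc
  split_ifs <;> simp [hx]

theorem partSum_trunc_le {x : ℕ → ℝ} (hx : ∀ j, 0 ≤ x j) (B n : ℕ) :
    partSum (trunc x B) n ≤ partSum x n := by
  classical
  refine Finset.sum_le_sum fun p _ => ?_
  rw [partWeight_trunc]
  split_ifs
  · exact le_rfl
  · exact partWeight_nonneg hx _

theorem partSum_trunc_of_lt (x : ℕ → ℝ) {B n : ℕ} (h : n < B) :
    partSum (trunc x B) n = partSum x n :=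
  partSum_congr fun j _ hj => by simp [trunc, hj.trans_lt h]

/-! ### Partitions with and without large parts -/

/-- A partition either has all parts smaller than `B`, or it has a part of size at least `B`. -/
theorem partSum_le {x : ℕ → ℝ} (hx : ∀ j, 0 ≤ x j) {B : ℕ} (hB : 1 ≤ B) (n : ℕ) :
    partSum x n ≤ partSum (trunc x B) n + ∑ j ∈ Finset.Icc B n, x j * partSum x (n - j) := by
  classical
  have h : ∀ j ∈ Finset.Icc B n, x j * partSum x (n - j)
      = ∑ p : n.Partition, (p.parts.count j : ℝ) * partWeight x p.parts := by
    intro j hj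
    rw [Finset.mem_Icc] at hj
    exact (sum_count_mul_partWeight_one x (hB.trans hj.1) hj.2).symm
  rw [Finset.sum_congr rfl h, Finset.sum_comm, partSum, partSum, ← Finset.sum_add_distrib]
  refine Finset.sum_le_sum fun p _ => ?_
  rw [partWeight_trunc, ← Finset.sum_mul]
  have hw := partWeight_nonneg hx p.parts
  split_ifs with hp
  · exact le_add_of_nonneg_right (mul_nonneg (Finset.sum_nonneg fun _ _ => by positivity) hw)
  · push Not at hp
    obtain ⟨i, hi, hiB⟩ := hp
    rw [zero_add]
    -- Union bound: the number of parts of size at least B is at least 1.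
    refine le_mul_of_one_le_left hw ?_
    refine le_trans ?_ (Finset.single_le_sum (f := fun j => (p.parts.count j : ℝ))
      (fun _ _ => by positivity) (Finset.mem_Icc.2 ⟨hiB, p.le_of_mem_parts hi⟩))
    exact_mod_cast Multiset.one_le_count_iff_mem.2 hi

/-- The weight of the partitions with exactly one part of size at least `B`, this part being a
member of `J`. -/
theorem sum_mul_partSum_trunc_le {x : ℕ → ℝ} (hx : ∀ j, 0 ≤ x j) {B n : ℕ} (hB : 1 ≤ B)
    {J : Finset ℕ} (hJ : J ⊆ Finset.Icc B n) (G : Multiset ℕ → ℝ) (hG : ∀ s, 0 ≤ G s)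
    (hG1 : ∀ p : n.Partition, ∀ j ∈ J, j ∈ p.parts → (∀ i ∈ p.parts.erase j, i < B) →
      1 ≤ G p.parts) :
    ∑ j ∈ J, x j * partSum (trunc x B) (n - j) 
      ≤ ∑ p : n.Partition, G p.parts * partWeight x p.parts := by
  classical
  have h : ∀ j ∈ J, x j * partSum (trunc x B) (n - j)
      = ∑ p : n.Partition, (p.parts.count j : ℝ) * (if ∀ i ∈ p.parts.erase j, i < B then 1 else 0)
          * partWeight x p.parts := by
    intro j hj
    have hj' := Finset.mem_Icc.1 (hJ hj)
    rw [sum_count_mul_partWeight x (fun s => if ∀ i ∈ s, i < B then 1 else 0)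
      (hB.trans hj'.1) hj'.2, partSum]
    congr 1
    refine Finset.sum_congr rfl fun p _ => ?_
    rw [partWeight_trunc]
    split_ifs <;> simp
  rw [Finset.sum_congr rfl h, Finset.sum_comm]
  refine Finset.sum_le_sum fun p _ => ?_
  rw [← Finset.sum_mul]
  refine mul_le_mul_of_nonneg_right ?_ (partWeight_nonneg hx _)
  -- At most one j in the sum contributes: members of J are at least B, so if removing one copy of j
  -- leaves only parts below B, then j has multiplicity one and no other member of J is a part.
  by_cases hp : ∃ j ∈ J, j ∈ p.parts ∧ ∀ i ∈ p.parts.erase j, i < B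
  · obtain ⟨j, hj, hjp, hji⟩ := hp
    rw [Finset.sum_eq_single_of_mem j hj]
    · rw [if_pos hji, mul_one]
      have hc : p.parts.count j = 1 := by
        have h1 : j ∉ p.parts.erase j := fun hm =>
          absurd (hji j hm) (Finset.mem_Icc.1 (hJ hj)).1.not_gt
        have h2 := Multiset.count_erase_self j p.parts
        rw [Multiset.count_eq_zero_of_notMem h1] at h2
        have h3 := Multiset.one_le_count_iff_mem.2 hjp
        omega
      rw [hc, Nat.cast_one]
      exact hG1 p j hj hjp hji
    · intro i hi hij
      have h1 : i ∉ p.parts := fun hm =>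
        absurd (hji i ((Multiset.mem_erase_of_ne hij).2 hm)) (Finset.mem_Icc.1 (hJ hi)).1.not_gt
      simp [Multiset.count_eq_zero_of_notMem h1]
  · push Not at hp
    rw [Finset.sum_eq_zero]
    · exact hG _
    · intro j hj
      by_cases hjp : j ∈ p.parts
      · obtain ⟨i, hi, hiB⟩ := hp j hj hjp
        rw [if_neg (fun h => absurd (h i hi) hiB.not_gt), mul_zero]
      · simp [Multiset.count_eq_zero_of_notMem hjp]

/-! ## From permutations to partitions -/

/-- `Equiv.Perm.cycleType` omits fixed points whereas `Equiv.Perm.partition` lists them as ones;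
this splitting translates between the two. -/
theorem parts_eq_filter_add_replicate {n : ℕ} (p : n.Partition) :
    p.parts = p.parts.filter (2 ≤ ·)
      + Multiset.replicate (n - (p.parts.filter (2 ≤ ·)).sum) 1 := by
  have h1 : p.parts.filter (fun j => ¬ 2 ≤ j)
      = Multiset.replicate (p.parts.filter fun j => ¬ 2 ≤ j).card 1 := by
    refine Multiset.eq_replicate.2 ⟨rfl, fun j hj => ?_⟩
    rw [Multiset.mem_filter] at hj
    have := p.parts_pos hj.1
    omega
  have h2 := Multiset.filter_add_not (2 ≤ ·) p.parts
  have h3 := congrArg Multiset.sum h2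
  rw [Multiset.sum_add, p.parts_sum, h1, Multiset.sum_replicate, smul_eq_mul, mul_one] at h3
  conv_lhs => rw [← h2, h1]
  congr 2
  omega

/-- Cauchy's formula for the size of a conjugacy class, with the fixed points absorbed into the
factor of index 1. -/
theorem card_partition_mul_eq {α : Type*} [Fintype α] [DecidableEq α]
    (p : (Fintype.card α).Partition) :
    (Finset.univ.filter fun σ : Equiv.Perm α => σ.partition = p).card
      * ∏ j ∈ p.parts.toFinset, (j ^ p.parts.count j * (p.parts.count j).factorial)
      = (Fintype.card α).factorial := by
  have hparts := parts_eq_filter_add_replicate p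
  set m := p.parts.filter (2 ≤ ·) with hm
  have hms : m.sum ≤ Fintype.card α := by
    have := congrArg Multiset.sum hparts
    rw [Multiset.sum_add, p.parts_sum] at this
    omega
  have hm2 : ∀ a ∈ m, 2 ≤ a := fun a ha => (Multiset.mem_filter.1 ha).2
  have h1 : (Finset.univ.filter fun σ : Equiv.Perm α => σ.partition = p)
      = Finset.univ.filter fun σ : Equiv.Perm α => σ.cycleType = m := by
    ext σ
    simp only [Finset.mem_filter, Finset.mem_univ, true_and]
    constructor
    · rintro rfl
      rw [hm, Equiv.Perm.filter_parts_partition_eq_cycleType]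
    · intro h
      refine Nat.Partition.ext ?_
      rw [hparts, Equiv.Perm.parts_partition, ← Equiv.Perm.sum_cycleType, h]
  have h2 := Equiv.Perm.card_of_cycleType_mul_eq α m
  rw [if_pos ⟨hms, hm2⟩] at h2
  rw [← h2, h1]
  congr 1
  have h1m : 1 ∉ m := fun h => absurd (hm2 1 h) (by norm_num)
  have hc1 : p.parts.count 1 = Fintype.card α - m.sum := by
    rw [hparts, Multiset.count_add, Multiset.count_eq_zero_of_notMem h1m,
      Multiset.count_replicate_self, zero_add]
  have hcm : ∀ j ∈ m.toFinset, p.parts.count j = m.count j := by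
    intro j hj
    have : j ≠ 1 := by
      rintro rfl
      exact h1m (Multiset.mem_toFinset.1 hj)
    rw [hparts, Multiset.count_add, Multiset.count_replicate, if_neg this.symm, add_zero]
  have hsub : p.parts.toFinset ⊆ insert 1 m.toFinset := by
    intro j hj
    rw [Multiset.mem_toFinset, hparts, Multiset.mem_add] at hj
    rw [Finset.mem_insert, Multiset.mem_toFinset]
    rcases hj with hj | hj
    · exact Or.inr hj
    · exact Or.inl (Multiset.eq_of_mem_replicate hj)
  rw [Finset.prod_subset hsub (fun j _ hj => by
    rw [Multiset.mem_toFinset] at hj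
    simp [Multiset.count_eq_zero_of_notMem hj]),
    Finset.prod_insert (by simpa using h1m), hc1, one_pow, one_mul, mul_assoc,
    Finset.prod_multiset_count m, ← Finset.prod_mul_distrib]
  congr 1
  exact Finset.prod_congr rfl fun j hj => by rw [hcm j hj]

/-- Summation over conjugacy classes. The factors j^{m_j} in Cauchy's formula turn the weights w_j
into w_j / j. -/
theorem sum_perm_eq_sum_partition {α : Type*} [Fintype α] [DecidableEq α] {n : ℕ}
    (hn : Fintype.card α = n) (w : ℕ → ℝ) (G : Multiset ℕ → ℝ) :
    ∑ σ : Equiv.Perm α, (∏ j ∈ Finset.Icc 1 n, w j ^ σ.partition.parts.count j)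
        * G σ.partition.parts
      = n.factorial * ∑ p : n.Partition, G p.parts * partWeight (fun j => w j / j) p.parts := by
  subst hn
  rw [← Finset.sum_fiberwise_of_maps_to (s := Finset.univ) (t := Finset.univ)
    (g := fun σ : Equiv.Perm α => σ.partition) (fun _ _ => Finset.mem_univ _), Finset.mul_sum]
  refine Finset.sum_congr rfl fun p _ => ?_
  have h1 : ∀ σ ∈ Finset.univ.filter (fun σ : Equiv.Perm α => σ.partition = p),
      (∏ j ∈ Finset.Icc 1 (Fintype.card α), w j ^ σ.partition.parts.count j)
        * G σ.partition.parts
      = (∏ j ∈ p.parts.toFinset, w j ^ p.parts.count j) * G p.parts := by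
    intro σ hσ
    rw [(Finset.mem_filter.1 hσ).2]
    congr 1
    symm
    refine Finset.prod_subset (fun j hj => ?_) fun j _ hj => ?_
    · rw [Multiset.mem_toFinset] at hj
      exact Finset.mem_Icc.2 ⟨p.parts_pos hj, p.le_of_mem_parts hj⟩
    · rw [Multiset.mem_toFinset] at hj
      simp [Multiset.count_eq_zero_of_notMem hj]
  rw [Finset.sum_congr rfl h1, Finset.sum_const, nsmul_eq_mul, ← card_partition_mul_eq p,
    partWeight]
  have h2 : ∏ j ∈ p.parts.toFinset, w j ^ p.parts.count j
      = (∏ j ∈ p.parts.toFinset, ((j : ℝ) ^ p.parts.count j * (p.parts.count j).factorial))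
        * ∏ j ∈ p.parts.toFinset, (w j / j) ^ p.parts.count j / (p.parts.count j).factorial := by
    rw [← Finset.prod_mul_distrib]
    refine Finset.prod_congr rfl fun j hj => ?_
    have h3 : (j : ℝ) ≠ 0 := by
      have := p.parts_pos (Multiset.mem_toFinset.1 hj)
      positivity
    have h4 : ((p.parts.count j).factorial : ℝ) ≠ 0 := by positivity
    rw [div_pow]
    field_simp
  rw [h2]
  push_cast
  ring

/-- The rescaled weights `(θ_j + N κ_j) R^j / j`. -/
noncomputable def cycleIntensity (θ κ : ℕ → ℝ) (R : ℝ) (N j : ℕ) : ℝ :=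
  θ j / j * R ^ j + N * (κ j / j * R ^ j)

theorem sum_weight_mul (θ κ : ℕ → ℝ) {R : ℝ} (hR : 0 < R) (N : ℕ) (G : Multiset ℕ → ℝ) :
    ∑ σ : Equiv.Perm (Fin N), weight θ κ N σ * G σ.partition.parts
      = N.factorial / R ^ N * ∑ p : N.Partition, G p.parts
          * partWeight (cycleIntensity θ κ R N) p.parts := by
  have h := sum_perm_eq_sum_partition (Fintype.card_fin N) (fun j => θ j + N * κ j) G
  have h2 : ∀ p : N.Partition, partWeight (cycleIntensity θ κ R N) p.parts
      = R ^ N * partWeight (fun j => (θ j + N * κ j) / j) p.parts := by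
    intro p
    have := partWeight_scale (fun j => (θ j + N * κ j) / j) R p.parts
    rw [p.parts_sum] at this
    rw [← this]
    exact partWeight_congr fun j _ => by rw [cycleIntensity]; ring
  simp only [weight, cycleCount, h, h2]
  rw [Finset.mul_sum, Finset.mul_sum]
  refine Finset.sum_congr rfl fun p _ => ?_
  field_simp

theorem normConst_eq (θ κ : ℕ → ℝ) {R : ℝ} (hR : 0 < R) (N : ℕ) :
    normConst θ κ N = partSum (cycleIntensity θ κ R N) N / R ^ N := by
  have h := sum_weight_mul θ κ hR N fun _ => 1
  simp only [mul_one, one_mul] at h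
  rw [normConst, h, partSum]
  have : (N.factorial : ℝ) ≠ 0 := by positivity
  field_simp

theorem expect_eq (θ κ : ℕ → ℝ) {R : ℝ} (hR : 0 < R) (N : ℕ) (G : Multiset ℕ → ℝ) :
    expect θ κ N (fun σ => G σ.partition.parts)
      = (∑ p : N.Partition, G p.parts * partWeight (cycleIntensity θ κ R N) p.parts)
        / partSum (cycleIntensity θ κ R N) N := by
  have h := sum_weight_mul θ κ hR N G
  simp only [expect, pointProb, mul_assoc]
  rw [← Finset.mul_sum, h, normConst_eq θ κ hR]
  have h1 : (N.factorial : ℝ) ≠ 0 := by positivity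
  have h2 : R ^ N ≠ 0 := by positivity
  field_simp

/-! ## Exponential moment bounds -/

/-- The intensities only have moments of order below s, possibly fewer than two, so the second-order
Taylor remainder is weakened to order 1 + α. For |y| ≤ 1 this follows from y² ≤ |y|^{1+α}; for |y| >
1 the remainder term alone dominates e^y if y ≥ 0, and it dominates |y| if y < 0. -/
theorem exp_le_one_add_add_rpow {α : ℝ} (hα : 0 < α) (hα1 : α ≤ 1) (y : ℝ) :
    Real.exp y ≤ 1 + y + |y| ^ (1 + α) * Real.exp |y| := by
  have he : 1 ≤ Real.exp |y| := Real.one_le_exp (abs_nonneg y)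
  rcases le_or_gt |y| 1 with hy | hy
  · have h1 := (abs_le.1 (Real.abs_exp_sub_one_sub_id_le hy)).2
    have h2 : y ^ 2 ≤ |y| ^ (1 + α) := by
      rcases eq_or_ne y 0 with rfl | h0
      · simp [Real.zero_rpow (show 1 + α ≠ 0 by linarith)]
      · rw [← sq_abs, ← Real.rpow_natCast]
        exact Real.rpow_le_rpow_of_exponent_ge (abs_pos.2 h0) hy (by push_cast; linarith)
    have h3 : |y| ^ (1 + α) ≤ |y| ^ (1 + α) * Real.exp |y| :=
      le_mul_of_one_le_right (by positivity) he
    linarith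
  · have h1 : |y| ≤ |y| ^ (1 + α) := by
      conv_lhs => rw [← Real.rpow_one |y|]
      exact Real.rpow_le_rpow_of_exponent_le hy.le (by linarith)
    rcases le_or_gt 0 y with h0 | h0
    · rw [abs_of_nonneg h0] at *
      have h2 : Real.exp y ≤ y ^ (1 + α) * Real.exp y :=
        le_mul_of_one_le_left (Real.exp_pos y).le (by linarith)
      linarith
    · have h2 : |y| ≤ |y| ^ (1 + α) * Real.exp |y| :=
        h1.trans (le_mul_of_one_le_right (by positivity) he)
      have h3 : Real.exp y ≤ 1 := Real.exp_le_one_iff.2 h0.le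
      rw [abs_of_neg h0] at h2 ⊢
      linarith

/-- Chernoff bound: on S the factor e^{t(m - c)} is at least 1, and the tilted sums have total mass
exp(∑ x_j e^{tj}) by `hasSum_partSum_trunc`. The exponent is then expanded to first order with a
remainder of order 1 + α. Either sign of t is allowed, which covers both tails. -/
theorem sum_partSum_trunc_le_exp {x : ℕ → ℝ} (hx : ∀ j, 0 ≤ x j) {B : ℕ} {α t l E c : ℝ}
    (hα : 0 < α) (hα1 : α ≤ 1) (ht : |t| = l) (hE : ∀ j : ℕ, j < B → Real.exp (l * j) ≤ E)
    {S : Finset ℕ} (hS : ∀ m ∈ S, t * c ≤ t * m) :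
    ∑ m ∈ S, partSum (trunc x B) m ≤ Real.exp (-(t * c) + ∑ j ∈ Finset.Ico 1 B, x j
      + t * ∑ j ∈ Finset.Ico 1 B, j * x j
      + l ^ (1 + α) * E * ∑ j ∈ Finset.Ico 1 B, (j : ℝ) ^ (1 + α) * x j) := by
  have hl : 0 ≤ l := ht ▸ abs_nonneg t
  have hy : ∀ j, 0 ≤ x j * Real.exp t ^ j := fun j => mul_nonneg (hx j) (by positivity)
  have h1 : ∀ m, partSum (trunc (fun j => x j * Real.exp t ^ j) B) m
      = Real.exp (t * m) * partSum (trunc x B) m := by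
    intro m
    rw [mul_comm t, Real.exp_nat_mul, ← partSum_scale]
    refine partSum_congr fun j _ _ => ?_
    simp only [trunc]
    split_ifs <;> simp
  have h2 : ∑ m ∈ S, partSum (trunc x B) m
      ≤ ∑ m ∈ S, Real.exp (-(t * c)) * partSum (trunc (fun j => x j * Real.exp t ^ j) B) m := by
    refine Finset.sum_le_sum fun m hm => ?_
    rw [h1, ← mul_assoc, ← Real.exp_add]
    refine le_mul_of_one_le_left (partSum_nonneg (trunc_nonneg hx B) m) (Real.one_le_exp ?_)
    have := hS m hm
    linarith
  have h3 := sum_le_hasSum S (fun m _ => partSum_nonneg (trunc_nonneg hy B) m)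
    (hasSum_partSum_trunc hy B)
  rw [← Finset.mul_sum] at h2
  refine h2.trans ((mul_le_mul_of_nonneg_left h3 (Real.exp_pos _).le).trans ?_)
  rw [← Real.exp_add, Real.exp_le_exp, add_assoc, add_assoc]
  refine add_le_add_right ?_ _
  rw [Finset.mul_sum, Finset.mul_sum, ← Finset.sum_add_distrib, ← Finset.sum_add_distrib]
  refine Finset.sum_le_sum fun j hj => ?_
  have h4 := exp_le_one_add_add_rpow hα hα1 (t * j)
  rw [abs_mul, ht, Nat.abs_cast, Real.mul_rpow hl (Nat.cast_nonneg j)] at h4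
  have h5 : l ^ (1 + α) * (j : ℝ) ^ (1 + α) * Real.exp (l * j)
      ≤ l ^ (1 + α) * (j : ℝ) ^ (1 + α) * E :=
    mul_le_mul_of_nonneg_left (hE j (Finset.mem_Ico.1 hj).2) (by positivity)
  rw [← Real.exp_nat_mul, mul_comm (j : ℝ) t]
  calc x j * Real.exp (t * j)
      ≤ x j * (1 + t * j + l ^ (1 + α) * (j : ℝ) ^ (1 + α) * E) :=
        mul_le_mul_of_nonneg_left (h4.trans (by linarith)) (hx j)
    _ = _ := by ring

/-! ## Heavy-tailed intensities -/

/-- Intensities `q j + N p j` for which `p j ∼ A j^{-s-1}`, `q j = o(j^{-s-1})` and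
`∑ j p_j = μ < 1`. -/
structure HeavyTailed (p q : ℕ → ℝ) (s A μ : ℝ) : Prop where
  p_nonneg : ∀ j, 0 ≤ p j
  q_nonneg : ∀ j, 0 ≤ q j
  one_lt : 1 < s
  pos : 0 < A
  tendsto_p : Tendsto (fun j : ℕ => p j * (j : ℝ) ^ (s + 1)) atTop (𝓝 A)
  tendsto_q : Tendsto (fun j : ℕ => q j * (j : ℝ) ^ (s + 1)) atTop (𝓝 0)
  mean : HasSum (fun j : ℕ => (j : ℝ) * p j) μ
  lt_one : μ < 1

/-- The intensities `q j + N p j`. -/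
def intensity (p q : ℕ → ℝ) (N j : ℕ) : ℝ := q j + N * p j

/-- The total mass of the partition sums with intensities cut off after `N`. -/
noncomputable def totalMass (p q : ℕ → ℝ) (N : ℕ) : ℝ :=
  Real.exp (∑ j ∈ Finset.Ico 1 (N + 1), intensity p q N j)

theorem totalMass_pos (p q : ℕ → ℝ) (N : ℕ) : 0 < totalMass p q N := Real.exp_pos _

/-- Comparison with j^{r-s-1}, whose exponent is below -1. -/
theorem summable_rpow_mul_of_tendsto {p : ℕ → ℝ} {s L r : ℝ}
    (h : Tendsto (fun j : ℕ => p j * (j : ℝ) ^ (s + 1)) atTop (𝓝 L)) (hr : r < s) :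
    Summable fun j : ℕ => (j : ℝ) ^ r * p j := by
  refine summable_of_isBigO_nat (g := fun j : ℕ => (j : ℝ) ^ (r - (s + 1)))
    (Real.summable_nat_rpow.2 (by linarith)) ?_
  have h1 := (h.isBigO_one ℝ).mul (isBigO_refl (fun j : ℕ => (j : ℝ) ^ (r - (s + 1))) atTop)
  refine (h1.congr' ?_ ?_)
  · filter_upwards [eventually_ge_atTop 1] with j hj
    have hj' : (0 : ℝ) < j := by exact_mod_cast hj
    rw [mul_assoc, ← Real.rpow_add hj', mul_comm]
    congr 2
    ring
  · exact Eventually.of_forall fun j => by simp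

namespace HeavyTailed

variable {p q : ℕ → ℝ} {s A μ : ℝ}

theorem intensity_nonneg (h : HeavyTailed p q s A μ) (N j : ℕ) : 0 ≤ intensity p q N j :=
  add_nonneg (h.q_nonneg j) (mul_nonneg (Nat.cast_nonneg N) (h.p_nonneg j))

theorem intensity_mul_bounds (h : HeavyTailed p q s A μ) {η : ℝ} (hη : 0 < η) :
    ∀ᶠ j : ℕ in atTop, ∀ N : ℕ, 1 ≤ N →
      (A - η) * N ≤ intensity p q N j * (j : ℝ) ^ (s + 1) ∧
      intensity p q N j * (j : ℝ) ^ (s + 1) ≤ (A + η) * N := by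
  -- Half of the upper slack η is reserved for q, which satisfies q j · j^{s+1} < η/2 ≤ (η/2) N.
  filter_upwards [h.tendsto_p.eventually (Ioo_mem_nhds (show A - η < A by linarith)
    (show A < A + η / 2 by linarith)), h.tendsto_q.eventually (gt_mem_nhds (half_pos hη))]
    with j hp hq N hN
  have hN' : (1 : ℝ) ≤ N := by exact_mod_cast hN
  have hq0 : 0 ≤ q j * (j : ℝ) ^ (s + 1) := mul_nonneg (h.q_nonneg j) (by positivity)
  rw [intensity, add_mul, mul_assoc]
  constructor
  · nlinarith [hp.1]
  · nlinarith [hp.2]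

theorem intensity_le (h : HeavyTailed p q s A μ) {η c : ℝ} (hη : 0 < η) (hc : 0 < c) :
    ∀ᶠ N : ℕ in atTop, ∀ j : ℕ, c * N ≤ j →
      intensity p q N j ≤ (A + η) * c ^ (-(s + 1)) * (N : ℝ) ^ (-s) := by
  obtain ⟨J, hJ⟩ := eventually_atTop.1 (h.intensity_mul_bounds hη)
  have ht : Tendsto (fun N : ℕ => c * (N : ℝ)) atTop atTop :=
    tendsto_natCast_atTop_atTop.const_mul_atTop hc
  filter_upwards [ht.eventually_ge_atTop (J : ℝ), eventually_ge_atTop 1] with N hN hN1 j hj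
  have hN' : (0 : ℝ) < N := by exact_mod_cast hN1
  have hcN : 0 < c * N := by positivity
  have hj0 : (0 : ℝ) < j := hcN.trans_le hj
  have h1 := (hJ j (by exact_mod_cast hN.trans hj) N hN1).2
  have hA := h.pos
  have hs := h.one_lt
  have h2 : (N : ℝ) ^ (-s) = N * (N : ℝ) ^ (-(s + 1)) := by
    conv_rhs => rw [← Real.rpow_one_add' hN'.le (by linarith)]
    congr 1
    ring
  have h3 : (j : ℝ) ^ (-(s + 1)) ≤ (c * N) ^ (-(s + 1)) :=
    Real.rpow_le_rpow_of_nonpos hcN hj (by linarith)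
  rw [Real.mul_rpow hc.le hN'.le] at h3
  calc intensity p q N j = intensity p q N j * (j : ℝ) ^ (s + 1) * (j : ℝ) ^ (-(s + 1)) := by
        rw [mul_assoc, ← Real.rpow_add hj0, add_neg_cancel, Real.rpow_zero, mul_one]
    _ ≤ (A + η) * N * (c ^ (-(s + 1)) * (N : ℝ) ^ (-(s + 1))) :=
        mul_le_mul h1 h3 (by positivity) (by positivity)
    _ = _ := by rw [h2]; ring

theorem le_intensity (h : HeavyTailed p q s A μ) {η c c' : ℝ} (hη : 0 < η)
    (hc' : 0 < c') (hc : 0 < c) :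
    ∀ᶠ N : ℕ in atTop, ∀ j : ℕ, c' * N ≤ j → j ≤ c * N →
      (A - η) * c ^ (-(s + 1)) * (N : ℝ) ^ (-s) ≤ intensity p q N j := by
  obtain ⟨J, hJ⟩ := eventually_atTop.1 (h.intensity_mul_bounds hη)
  have ht : Tendsto (fun N : ℕ => c' * (N : ℝ)) atTop atTop :=
    tendsto_natCast_atTop_atTop.const_mul_atTop hc'
  filter_upwards [ht.eventually_ge_atTop (J : ℝ), eventually_ge_atTop 1] with N hN hN1 j hj hj2
  have hN' : (0 : ℝ) < N := by exact_mod_cast hN1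
  have hcN : 0 < c' * N := by positivity
  have hj0 : (0 : ℝ) < j := hcN.trans_le hj
  have h1 := (hJ j (by exact_mod_cast hN.trans hj) N hN1).1
  have hs := h.one_lt
  have h2 : (N : ℝ) ^ (-s) = N * (N : ℝ) ^ (-(s + 1)) := by
    conv_rhs => rw [← Real.rpow_one_add' hN'.le (by linarith)]
    congr 1
    ring
  have h3 : (c * N) ^ (-(s + 1)) ≤ (j : ℝ) ^ (-(s + 1)) :=
    Real.rpow_le_rpow_of_nonpos hj0 hj2 (by linarith)
  rw [Real.mul_rpow hc.le hN'.le] at h3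
  calc (A - η) * c ^ (-(s + 1)) * (N : ℝ) ^ (-s)
      = (A - η) * N * (c ^ (-(s + 1)) * (N : ℝ) ^ (-(s + 1))) := by rw [h2]; ring
    _ ≤ intensity p q N j * (j : ℝ) ^ (s + 1) * (j : ℝ) ^ (-(s + 1)) :=
        mul_le_mul h1 h3 (by positivity) (mul_nonneg (h.intensity_nonneg N j) (by positivity))
    _ = intensity p q N j := by
        rw [mul_assoc, ← Real.rpow_add hj0, add_neg_cancel, Real.rpow_zero, mul_one]

/-- The mass of the intensities above `b N` vanishes. -/
theorem tendsto_sum_intensity_large (h : HeavyTailed p q s A μ) {b : ℝ} (hb : 0 < b) :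
    Tendsto (fun N : ℕ => ∑ j ∈ Finset.Ico ⌈b * N⌉₊ (N + 1), intensity p q N j) atTop (𝓝 0) := by
  have hs := h.one_lt
  have h1 := h.intensity_le h.pos hb
  set K := (A + A) * b ^ (-(s + 1)) with hK
  have hK0 : 0 ≤ K := by have := h.pos; positivity
  -- At most N + 1 ≤ 2N terms, each O(N^{-s}), give O(N^{1-s}) with s > 1.
  have h2 : Tendsto (fun N : ℕ => 2 * K * (N : ℝ) ^ (-(s - 1))) atTop (𝓝 0) := by
    simpa using ((tendsto_rpow_neg_atTop (show 0 < s - 1 by linarith)).comp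
      tendsto_natCast_atTop_atTop).const_mul (2 * K)
  refine tendsto_of_tendsto_of_tendsto_of_le_of_le' tendsto_const_nhds h2
    (Eventually.of_forall fun N => Finset.sum_nonneg fun j _ => h.intensity_nonneg N j) ?_
  filter_upwards [h1, eventually_ge_atTop 1] with N hN hN1
  have hN' : (1 : ℝ) ≤ N := by exact_mod_cast hN1
  have h3 : ∑ j ∈ Finset.Ico ⌈b * N⌉₊ (N + 1), intensity p q N j
      ≤ (Finset.Ico ⌈b * (N : ℝ)⌉₊ (N + 1)).card • (K * (N : ℝ) ^ (-s)) :=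
    Finset.sum_le_card_nsmul _ _ _ fun j hj =>
      hN j (Nat.ceil_le.1 (Finset.mem_Ico.1 hj).1)
  refine h3.trans ?_
  rw [nsmul_eq_mul, Nat.card_Ico]
  have h4 : ((N + 1 - ⌈b * (N : ℝ)⌉₊ : ℕ) : ℝ) ≤ 2 * N := by
    calc ((N + 1 - ⌈b * (N : ℝ)⌉₊ : ℕ) : ℝ) ≤ ((N + 1 : ℕ) : ℝ) := by
          exact_mod_cast Nat.sub_le _ _
      _ ≤ 2 * N := by push_cast; linarith
  have h5 : (N : ℝ) ^ (-(s - 1)) = N * (N : ℝ) ^ (-s) := by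
    rw [← Real.rpow_one_add' (by linarith) (by linarith)]
    congr 1
    ring
  rw [h5]
  calc _ ≤ 2 * N * (K * (N : ℝ) ^ (-s)) := mul_le_mul_of_nonneg_right h4 (by positivity)
    _ = _ := by ring

/-- The q-part has a finite first moment and vanishes after division by N; the p-part is a partial
sum of the series for μ. -/
theorem tendsto_truncated_mean (h : HeavyTailed p q s A μ) {b : ℝ} (hb : 0 < b) :
    Tendsto (fun N : ℕ => (∑ j ∈ Finset.Ico 1 ⌈b * N⌉₊, j * intensity p q N j) / N)
      atTop (𝓝 μ) := by
  have hB : Tendsto (fun N : ℕ => ⌈b * (N : ℝ)⌉₊) atTop atTop :=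
    tendsto_nat_ceil_atTop.comp (tendsto_natCast_atTop_atTop.const_mul_atTop hb)
  have hq : Summable fun j : ℕ => (j : ℝ) * q j := by
    simpa using summable_rpow_mul_of_tendsto h.tendsto_q h.one_lt
  have h0 : ∀ (g : ℕ → ℝ) (B : ℕ), ∑ j ∈ Finset.Ico 1 B, (j : ℝ) * g j
      = ∑ j ∈ Finset.range B, (j : ℝ) * g j := by
    intro g B
    refine Finset.sum_subset (fun j hj => ?_) fun j hj hj' => ?_
    · simp only [Finset.mem_Ico, Finset.mem_range] at *
      omega
    · simp only [Finset.mem_Ico, Finset.mem_range, not_and, not_lt] at *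
      have : j = 0 := by
        by_contra h0
        exact absurd (hj' (by omega)) (by omega)
      simp [this]
  have h1 := h.mean.tendsto_sum_nat.comp hB
  have h2 := (hq.hasSum.tendsto_sum_nat.comp hB).mul
    (tendsto_inv_atTop_zero.comp (tendsto_natCast_atTop_atTop (R := ℝ)))
  have h3 := h2.add h1
  rw [mul_zero, zero_add] at h3
  refine h3.congr' ?_
  filter_upwards [eventually_ge_atTop 1] with N hN
  have hN' : (N : ℝ) ≠ 0 := by positivity
  simp only [Function.comp_apply]
  rw [← h0, ← h0, Finset.sum_mul, ← Finset.sum_add_distrib, Finset.sum_div]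
  refine Finset.sum_congr rfl fun j _ => ?_
  rw [intensity]
  field_simp

theorem totalMass_eq (p q : ℕ → ℝ) {B N : ℕ} (hB : 1 ≤ B) (hBN : B ≤ N + 1) :
    totalMass p q N = Real.exp (∑ j ∈ Finset.Ico 1 B, intensity p q N j)
      * Real.exp (∑ j ∈ Finset.Ico B (N + 1), intensity p q N j) := by
  rw [totalMass, ← Real.exp_add, Finset.sum_Ico_consecutive _ hB hBN]

theorem exp_truncated_le (h : HeavyTailed p q s A μ) {B N : ℕ} (hB : 1 ≤ B) (hBN : B ≤ N + 1) :
    Real.exp (∑ j ∈ Finset.Ico 1 B, intensity p q N j) ≤ totalMass p q N := by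
  rw [totalMass_eq p q hB hBN]
  exact le_mul_of_one_le_right (Real.exp_pos _).le
    (Real.one_le_exp (Finset.sum_nonneg fun j _ => h.intensity_nonneg N j))

/-! ### Concentration of the partition sums around μN -/

theorem ceil_mul_bounds {b : ℝ} (hb : 0 < b) (hb1 : b ≤ 1) {N : ℕ} (hN : 1 ≤ N) :
    1 ≤ ⌈b * (N : ℝ)⌉₊ ∧ ⌈b * (N : ℝ)⌉₊ ≤ N + 1 := by
  have hN' : (0 : ℝ) < N := by exact_mod_cast hN
  refine ⟨Nat.one_le_ceil_iff.2 (by positivity), (Nat.ceil_le.2 ?_).trans (Nat.le_succ N)⟩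
  exact mul_le_of_le_one_left hN'.le hb1

/-- The remainder of the Chernoff exponent for the tilt C log N / N. As the moments of order 1 + α <
s of p and q are finite, it is at most of order (log N)^{1+α} N^{Cb - α}. -/
theorem tendsto_exp_moment_error (h : HeavyTailed p q s A μ) {α b C : ℝ} (hαs : 1 + α < s) (hC : 0 < C) (hCb : C * b < α) :
    Tendsto (fun N : ℕ => (C * Real.log N / N) ^ (1 + α) * (N : ℝ) ^ (C * b)
      * ∑ j ∈ Finset.Ico 1 ⌈b * (N : ℝ)⌉₊, (j : ℝ) ^ (1 + α) * intensity p q N j)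
      atTop (𝓝 0) := by
  have hp := summable_rpow_mul_of_tendsto h.tendsto_p hαs
  have hq := summable_rpow_mul_of_tendsto h.tendsto_q hαs
  set P := ∑' j : ℕ, (j : ℝ) ^ (1 + α) * p j
  set Q := ∑' j : ℕ, (j : ℝ) ^ (1 + α) * q j
  have hP : 0 ≤ P := tsum_nonneg fun j => mul_nonneg (by positivity) (h.p_nonneg j)
  have hQ : 0 ≤ Q := tsum_nonneg fun j => mul_nonneg (by positivity) (h.q_nonneg j)
  have h1 : Tendsto (fun N : ℕ => C ^ (1 + α) * (P + Q)
      * ((Real.log N) ^ (1 + α) / (N : ℝ) ^ (α - C * b))) atTop (𝓝 0) := by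
    simpa using ((isLittleO_log_rpow_rpow_atTop (1 + α)
      (show 0 < α - C * b by linarith)).tendsto_div_nhds_zero.comp
        tendsto_natCast_atTop_atTop).const_mul (C ^ (1 + α) * (P + Q))
  refine tendsto_of_tendsto_of_tendsto_of_le_of_le' tendsto_const_nhds h1
    (Eventually.of_forall fun N => ?_) ?_
  · have hl : 0 ≤ Real.log N := Real.log_natCast_nonneg N
    refine mul_nonneg (by positivity) (Finset.sum_nonneg fun j _ => ?_)
    exact mul_nonneg (by positivity) (h.intensity_nonneg N j)
  · filter_upwards [eventually_ge_atTop 1] with N hN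
    have hN' : (1 : ℝ) ≤ N := by exact_mod_cast hN
    have hN0 : (0 : ℝ) < N := by linarith
    have hl : 0 ≤ Real.log N := Real.log_natCast_nonneg N
    have h2 : ∑ j ∈ Finset.Ico 1 ⌈b * (N : ℝ)⌉₊, (j : ℝ) ^ (1 + α) * intensity p q N j
        ≤ N * (P + Q) := by
      have h3 := hp.sum_le_tsum (Finset.Ico 1 ⌈b * (N : ℝ)⌉₊)
        fun j _ => mul_nonneg (by positivity) (h.p_nonneg j)
      have h4 := hq.sum_le_tsum (Finset.Ico 1 ⌈b * (N : ℝ)⌉₊)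
        fun j _ => mul_nonneg (by positivity) (h.q_nonneg j)
      have h5 : ∑ j ∈ Finset.Ico 1 ⌈b * (N : ℝ)⌉₊, (j : ℝ) ^ (1 + α) * intensity p q N j
          = ∑ j ∈ Finset.Ico 1 ⌈b * (N : ℝ)⌉₊, (j : ℝ) ^ (1 + α) * q j
            + N * ∑ j ∈ Finset.Ico 1 ⌈b * (N : ℝ)⌉₊, (j : ℝ) ^ (1 + α) * p j := by
        rw [Finset.mul_sum, ← Finset.sum_add_distrib]
        exact Finset.sum_congr rfl fun j _ => by rw [intensity]; ring
      rw [h5]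
      change _ ≤ P at h3
      change _ ≤ Q at h4
      nlinarith
    refine (mul_le_mul_of_nonneg_left h2 (by positivity)).trans (le_of_eq ?_)
    have h6 : (N : ℝ) ^ (1 + α) = N ^ (α - C * b) * N ^ (C * b) * N := by
      rw [← Real.rpow_add hN0, ← Real.rpow_add_one hN0.ne']
      congr 1
      ring
    rw [Real.div_rpow (by positivity) hN0.le, Real.mul_rpow hC.le hl, h6]
    have h7 : (N : ℝ) ^ (C * b) ≠ 0 := by positivity
    field_simp

/-- Deviation bound for the partition sums without parts larger than `b N`. -/
theorem sum_partSum_trunc_far_le (h : HeavyTailed p q s A μ) {b C α ε : ℝ} (hb : 0 < b)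
    (hb1 : b ≤ 1) (hC : 0 < C) (hα : 0 < α) (hα1 : α ≤ 1) (hαs : 1 + α < s) (hCb : C * b < α)
    (hε : 0 < ε) :
    ∀ᶠ N : ℕ in atTop, ∀ S : Finset ℕ, (∀ m ∈ S, ε * N ≤ |(m : ℝ) - μ * N|) →
      ∑ m ∈ S, partSum (trunc (intensity p q N) ⌈b * (N : ℝ)⌉₊) m
        ≤ 2 * Real.exp 1 * (N : ℝ) ^ (-(C * ε / 2)) * totalMass p q N := by
  have hmean := (tendsto_order.1 (h.tendsto_truncated_mean hb))
  filter_upwards [eventually_ge_atTop 1, hmean.1 (μ - ε / 2) (by linarith),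
    hmean.2 (μ + ε / 2) (by linarith),
    (tendsto_order.1 (h.tendsto_exp_moment_error hαs hC hCb)).2 1 one_pos]
    with N hN hM1 hM2 herr S hS
  have hN0 : (0 : ℝ) < N := by exact_mod_cast hN
  have hlog : 0 ≤ Real.log N := Real.log_natCast_nonneg N
  obtain ⟨hB, hBN⟩ := ceil_mul_bounds hb hb1 hN
  have hT := h.exp_truncated_le hB hBN
  rw [lt_div_iff₀ hN0] at hM1
  rw [div_lt_iff₀ hN0] at hM2
  set B := ⌈b * (N : ℝ)⌉₊ with hBdef
  set M := ∑ j ∈ Finset.Ico 1 B, j * intensity p q N j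
  -- With this tilt a part of size at most bN is reweighted by at most N^{Cb}, while a deviation of
  -- order N is penalised by a power of N.
  set l := C * Real.log N / N with hl
  have hl0 : 0 ≤ l := by positivity
  have hlN : l * N = C * Real.log N := by rw [hl]; field_simp
  have hE : ∀ j : ℕ, j < B → Real.exp (l * j) ≤ (N : ℝ) ^ (C * b) := by
    intro j hj
    rw [Real.rpow_def_of_pos hN0, Real.exp_le_exp]
    have hj' : (j : ℝ) ≤ b * N := (Nat.lt_ceil.1 hj).le
    calc l * j ≤ l * (b * N) := mul_le_mul_of_nonneg_left hj' hl0
      _ = b * (l * N) := by ring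
      _ = _ := by rw [hlN]; ring
  -- One tail at a time: σ = 1 is the upper tail and σ = -1 the lower one.
  have key : ∀ (σ : ℝ), |σ| = 1 → ∀ S' : Finset ℕ,
      (∀ m ∈ S', σ * ((μ + σ * ε) * N) ≤ σ * m) →
      σ * M ≤ σ * ((μ + σ * (ε / 2)) * N) →
      ∑ m ∈ S', partSum (trunc (intensity p q N) B) m
        ≤ Real.exp 1 * (N : ℝ) ^ (-(C * ε / 2)) * totalMass p q N := by
    intro σ hσ S' hS' hM
    have hσ2 : σ * σ = 1 := by rw [← abs_mul_abs_self, hσ, one_mul]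
    have h1 := sum_partSum_trunc_le_exp (h.intensity_nonneg N) (B := B) (t := σ * l) (l := l)
      (c := (μ + σ * ε) * N) hα hα1 (by rw [abs_mul, hσ, one_mul, abs_of_nonneg hl0]) hE
      (S := S') (fun m hm => by
        have := mul_le_mul_of_nonneg_left (hS' m hm) hl0
        linarith)
    refine h1.trans ?_
    rw [Real.rpow_def_of_pos hN0 (-(C * ε / 2)), ← Real.exp_add]
    refine le_trans ?_ (mul_le_mul_of_nonneg_left hT (Real.exp_pos _).le)
    rw [← Real.exp_add, Real.exp_le_exp]
    have h2 := mul_le_mul_of_nonneg_left hM hl0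
    -- The truncated mean lies within ε/2 of μ (in units of N), so half of the deviation ε remains
    -- and produces N^{-Cε/2}. The remainder, below 1, goes into the factor e.
    have h3 : l * (σ * ((μ + σ * (ε / 2)) * N)) - σ * l * ((μ + σ * ε) * N)
        = -(C * ε / 2) * Real.log N := by
      linear_combination (-(l * N * ε / 2)) * hσ2 - (ε / 2) * hlN
    have h4 : l * (σ * M) = σ * l * M := by ring
    linarith [herr]
  have h1 := key 1 (by norm_num) (S.filter (fun m : ℕ => (μ + ε) * N ≤ m))
    (fun m hm => by simpa using (Finset.mem_filter.1 hm).2) (by linarith)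
  have h2 := key (-1) (by norm_num) (S.filter (fun m : ℕ => ¬ (μ + ε) * N ≤ m))
    (fun m hm => by
      obtain ⟨hm1, hm2⟩ := Finset.mem_filter.1 hm
      have h3 := hS m hm1
      rcases abs_cases ((m : ℝ) - μ * N) with h4 | h4 <;> linarith) (by linarith)
  rw [← Finset.sum_filter_add_sum_filter_not S (fun m : ℕ => (μ + ε) * N ≤ m)]
  linarith

theorem exists_exponent (h : HeavyTailed p q s A μ) :
    ∃ α : ℝ, 0 < α ∧ α ≤ 1 ∧ 1 + α < s := by
  have := h.one_lt
  refine ⟨min 1 ((s - 1) / 2), lt_min one_pos (by linarith), min_le_left _ _, ?_⟩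
  have := min_le_right 1 ((s - 1) / 2)
  linarith

/-- The partition sums without parts larger than `b N` concentrate around `μ N`. -/
theorem le_sum_partSum_trunc_near (h : HeavyTailed p q s A μ) {b ε ε' : ℝ} (hb : 0 < b)
    (hb1 : b ≤ 1) (hε : 0 < ε) (hε' : 0 < ε') :
    ∀ᶠ N : ℕ in atTop, ∀ W : Finset ℕ, (∀ m : ℕ, m ∉ W → ε * N ≤ |(m : ℝ) - μ * N|) →
      (1 - ε') * totalMass p q N
        ≤ ∑ m ∈ W, partSum (trunc (intensity p q N) ⌈b * (N : ℝ)⌉₊) m := by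
  obtain ⟨α, hα, hα1, hαs⟩ := h.exists_exponent
  -- The value C = α / (2b) gives Cb = α/2 < α.
  have hC : 0 < α / (2 * b) := by positivity
  have h1 := h.sum_partSum_trunc_far_le hb hb1 hC hα hα1 hαs
    (by rw [div_mul_eq_mul_div, div_lt_iff₀ (by positivity)]; nlinarith [mul_pos hα hb]) hε
  have h2 : Tendsto (fun N : ℕ => 2 * Real.exp 1 * (N : ℝ) ^ (-(α / (2 * b) * ε / 2)))
      atTop (𝓝 0) := by
    simpa using ((tendsto_rpow_neg_atTop (show 0 < α / (2 * b) * ε / 2 by positivity)).comp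
      tendsto_natCast_atTop_atTop).const_mul (2 * Real.exp 1)
  -- The mass of the partitions without parts of size at least bN is the total mass times this
  -- exponential, so the truncation loses a vanishing proportion.
  have h3 : Tendsto (fun N : ℕ => Real.exp (-∑ j ∈ Finset.Ico ⌈b * (N : ℝ)⌉₊ (N + 1),
      intensity p q N j)) atTop (𝓝 1) := by
    simpa [Function.comp_def] using
      (Real.continuous_exp.tendsto _).comp (h.tendsto_sum_intensity_large hb).neg
  filter_upwards [h1, eventually_ge_atTop 1, (tendsto_order.1 h2).2 (ε' / 2) (by linarith),
    (tendsto_order.1 h3).1 (1 - ε' / 2) (by linarith)] with N hN1 hN h2N h3N W hW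
  obtain ⟨hB, hBN⟩ := ceil_mul_bounds hb hb1 hN
  have hT := totalMass_eq p q hB hBN
  have hTp := totalMass_pos p q N
  have hx := h.intensity_nonneg N
  set B := ⌈b * (N : ℝ)⌉₊
  have hle : Real.exp (∑ j ∈ Finset.Ico 1 B, intensity p q N j)
      ≤ ∑ m ∈ W, partSum (trunc (intensity p q N) B) m + ε' / 2 * totalMass p q N := by
    refine hasSum_le_of_sum_le (hasSum_partSum_trunc hx B) fun S => ?_
    have h4 := hN1 (S.filter fun m => m ∉ W) fun m hm => hW m (Finset.mem_filter.1 hm).2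
    rw [← Finset.sum_filter_add_sum_filter_not S (fun m => m ∈ W)]
    refine add_le_add (Finset.sum_le_sum_of_subset_of_nonneg (fun m hm =>
      (Finset.mem_filter.1 hm).2) fun m _ _ => partSum_nonneg (trunc_nonneg hx B) m) ?_
    exact h4.trans (mul_le_mul_of_nonneg_right h2N.le hTp.le)
  have h5 : Real.exp (∑ j ∈ Finset.Ico 1 B, intensity p q N j)
      = totalMass p q N * Real.exp (-∑ j ∈ Finset.Ico B (N + 1), intensity p q N j) := by
    rw [hT, mul_assoc, ← Real.exp_add, add_neg_cancel, Real.exp_zero, mul_one]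
  rw [h5] at hle
  nlinarith

theorem sum_partSum_le_totalMass (h : HeavyTailed p q s A μ) {N : ℕ} {W : Finset ℕ}
    (hW : ∀ m ∈ W, m ≤ N) : ∑ m ∈ W, partSum (intensity p q N) m ≤ totalMass p q N := by
  have hx := h.intensity_nonneg N
  rw [Finset.sum_congr rfl fun m hm =>
    (partSum_trunc_of_lt (intensity p q N) (Nat.lt_succ_of_le (hW m hm))).symm]
  exact sum_le_hasSum W (fun m _ => partSum_nonneg (trunc_nonneg hx _) m)
    (hasSum_partSum_trunc hx (N + 1))

/-- The partition sums of indices away from `μ N` carry a negligible mass. -/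
theorem sum_partSum_far_le (h : HeavyTailed p q s A μ) {ε ε' : ℝ} (hε : 0 < ε)
    (hεμ : ε ≤ 1 - μ) (hε' : 0 < ε') :
    ∀ᶠ N : ℕ in atTop, ∀ W : Finset ℕ, (∀ m ∈ W, m ≤ N ∧ ε * N ≤ |(m : ℝ) - μ * N|) →
      ∑ m ∈ W, partSum (intensity p q N) m ≤ ε' * totalMass p q N := by
  filter_upwards [h.le_sum_partSum_trunc_near one_pos le_rfl hε hε'] with N hN W hW
  have hx := h.intensity_nonneg N
  -- The complement of W among the indices up to N already carries 1 - ε' of the mass, and all these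
  -- indices together carry at most the total. Indices above N are also far from μN, because ε ≤ 1 -
  -- μ.
  have h1 := hN (Finset.range (N + 1) \ W) (fun m hm => by
    rw [Finset.mem_sdiff, not_and_not_right] at hm
    by_cases hmN : m ∈ Finset.range (N + 1)
    · exact (hW m (hm hmN)).2
    · rw [Finset.mem_range, not_lt] at hmN
      have h2 : (N : ℝ) ≤ m := by exact_mod_cast (Nat.le_succ N).trans hmN
      have h3 : (0 : ℝ) ≤ N := Nat.cast_nonneg N
      refine le_trans ?_ (le_abs_self _)
      nlinarith)
  have h2 := h.sum_partSum_le_totalMass (N := N) (W := Finset.range (N + 1))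
    fun m hm => Nat.lt_succ_iff.1 (Finset.mem_range.1 hm)
  have hsub : W ⊆ Finset.range (N + 1) := fun m hm =>
    Finset.mem_range.2 (Nat.lt_succ_of_le (hW m hm).1)
  have h3 := Finset.sum_sdiff (f := partSum (intensity p q N)) hsub
  have h4 : ∑ m ∈ Finset.range (N + 1) \ W, partSum (trunc (intensity p q N) ⌈1 * (N : ℝ)⌉₊) m
      ≤ ∑ m ∈ Finset.range (N + 1) \ W, partSum (intensity p q N) m :=
    Finset.sum_le_sum fun m _ => partSum_trunc_le hx _ m
  linarith

end HeavyTailed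

/-! ### Asymptotics of the partition sums: one big part -/

theorem sum_sub_eq_sum_image {n : ℕ} {J : Finset ℕ} (hJ : ∀ j ∈ J, j ≤ n) (g : ℕ → ℝ) :
    ∑ j ∈ J, g (n - j) = ∑ m ∈ J.image (n - ·), g m := by
  rw [Finset.sum_image]
  intro a ha b hb hab
  have := hJ a ha
  have := hJ b hb
  simp only at hab
  omega

namespace HeavyTailed

variable {p q : ℕ → ℝ} {s A μ : ℝ}

theorem tendsto_const_mul_rpow_neg (h : HeavyTailed p q s A μ) :
    Tendsto (fun c : ℝ × ℝ => (A + c.1) * (1 - μ + c.2) ^ (-(s + 1))) (𝓝 0)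
      (𝓝 (A * (1 - μ) ^ (-(s + 1)))) := by
  have hν : 0 < 1 - μ := by linarith [h.lt_one]
  have hc : ContinuousAt (fun c : ℝ × ℝ => (A + c.1) * (1 - μ + c.2) ^ (-(s + 1))) 0 := by
    refine (continuousAt_const.add continuousAt_fst).mul
      (ContinuousAt.rpow_const (continuousAt_const.add continuousAt_snd) (Or.inl ?_))
    simpa using hν.ne'
  simpa [ContinuousAt] using hc

/-- A single η absorbs both the error in the tail constant A and the width of the window around 1 -
μ. -/
theorem exists_pos_const_mul_rpow_neg (h : HeavyTailed p q s A μ) {ε : ℝ} (hε : 0 < ε) :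
    ∃ η > 0, ∀ x y : ℝ, |x| ≤ η → |y| ≤ η →
      A * (1 - μ) ^ (-(s + 1)) - ε < (A + x) * (1 - μ + y) ^ (-(s + 1)) ∧
      (A + x) * (1 - μ + y) ^ (-(s + 1)) < A * (1 - μ) ^ (-(s + 1)) + ε := by
  obtain ⟨η, hη, hball⟩ := Metric.eventually_nhds_iff.1
    (h.tendsto_const_mul_rpow_neg.eventually (Ioo_mem_nhds
      (show A * (1 - μ) ^ (-(s + 1)) - ε < A * (1 - μ) ^ (-(s + 1)) by linarith)
      (show A * (1 - μ) ^ (-(s + 1)) < A * (1 - μ) ^ (-(s + 1)) + ε by linarith)))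
  refine ⟨η / 2, by linarith, fun x y hx hy => hball (y := (x, y)) ?_⟩
  rw [dist_zero_right, Prod.norm_def, max_lt_iff]
  exact ⟨by rw [Real.norm_eq_abs]; linarith, by rw [Real.norm_eq_abs]; linarith⟩

/-- Upper bound for the partition sums in the supercritical regime. -/
theorem partSum_sub_le (h : HeavyTailed p q s A μ) (k : ℕ) {ε : ℝ} (hε : 0 < ε) :
    ∀ᶠ N : ℕ in atTop, partSum (intensity p q N) (N - k)
      ≤ (A * (1 - μ) ^ (-(s + 1)) + ε) * (N : ℝ) ^ (-s) * totalMass p q N := by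
  have hA := h.pos
  have hs := h.one_lt
  set ν := 1 - μ with hν
  have hν0 : 0 < ν := by rw [hν]; linarith [h.lt_one]
  obtain ⟨α, hα, hα1, hαs⟩ := h.exists_exponent
  obtain ⟨η, hη, hη'⟩ := h.exists_pos_const_mul_rpow_neg (show 0 < ε / 4 by linarith)
  set δ := min η (ν / 2) with hδ
  have hδ0 : 0 < δ := lt_min hη (by linarith)
  have hδν : δ ≤ ν / 2 := min_le_right _ _
  have hup := (hη' η (-δ) (abs_of_pos hη).le
    (by rw [abs_neg, abs_of_pos hδ0]; exact min_le_left _ _)).2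
  rw [← hν] at hup
  -- Chosen so that a deviation of νN/2 costs N^{-Cν/4} = N^{-(s+1)}, negligible against N^{-s}.
  -- Then b is taken small enough that Cb < α.
  set C := 4 * (s + 1) / ν with hCdef
  have hC : 0 < C := by positivity
  set b := min 1 (α / (2 * C)) with hbdef
  have hb : 0 < b := lt_min one_pos (by positivity)
  have hCb : C * b < α := by
    have h1 : b ≤ α / (2 * C) := min_le_right _ _
    calc C * b ≤ C * (α / (2 * C)) := mul_le_mul_of_nonneg_left h1 hC.le
      _ = α / 2 := by field_simp
      _ < α := by linarith
  have hb1 : b ≤ 1 := min_le_left _ _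
  set K := (A + η) * b ^ (-(s + 1)) with hK
  have hK0 : 0 < K := by positivity
  have e1 := h.sum_partSum_trunc_far_le hb hb1 hC hα hα1 hαs hCb (half_pos hν0)
  have e2 := h.sum_partSum_far_le (half_pos hδ0) (by linarith)
    (show 0 < ε / (4 * K) by positivity)
  have e3 := h.intensity_le hη hb
  have e4 := h.intensity_le hη (show 0 < ν - δ by linarith)
  have e5 : Tendsto (fun N : ℕ => 2 * Real.exp 1 * (N : ℝ)⁻¹) atTop (𝓝 0) := by
    simpa using (tendsto_inv_atTop_zero.comp
      (tendsto_natCast_atTop_atTop (R := ℝ))).const_mul (2 * Real.exp 1)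
  have e6 := (tendsto_natCast_atTop_atTop (R := ℝ)).const_mul_atTop (half_pos hδ0)
  filter_upwards [e1, e2, e3, e4, (tendsto_order.1 e5).2 (ε / 4) (by linarith),
    e6.eventually_ge_atTop (k : ℝ), eventually_ge_atTop 1, eventually_ge_atTop k]
    with N h1 h2 h3 h4 h5 h6 hN hkN
  have hN0 : (0 : ℝ) < N := by exact_mod_cast hN
  obtain ⟨hB, -⟩ := ceil_mul_bounds hb hb1 hN
  have hT := totalMass_pos p q N
  have hx := h.intensity_nonneg N
  set B := ⌈b * (N : ℝ)⌉₊
  set T := totalMass p q N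
  set n := N - k with hn
  have hncast : (n : ℝ) = N - k := by rw [hn, Nat.cast_sub hkN]
  have hP : 0 < (N : ℝ) ^ (-s) := by positivity
  -- No part of size at least bN: the index N - k lies at distance νN - k ≥ νN/2 from μN, and the
  -- Chernoff bound applies.
  have hf : partSum (trunc (intensity p q N) B) n ≤ ε / 4 * (N : ℝ) ^ (-s) * T := by
    have h7 := h1 {n} fun m hm => by
      rw [Finset.mem_singleton.1 hm, hncast]
      refine le_trans ?_ (le_abs_self _)
      have : N - k - μ * N = ν * N - k := by rw [hν]; ring
      rw [this]
      nlinarith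
    rw [Finset.sum_singleton] at h7
    refine h7.trans (mul_le_mul_of_nonneg_right ?_ hT.le)
    have h8 : (N : ℝ) ^ (-(C * (ν / 2) / 2)) = (N : ℝ)⁻¹ * (N : ℝ) ^ (-s) := by
      rw [← Real.rpow_neg_one, ← Real.rpow_add hN0]
      congr 1
      rw [hCdef]
      field_simp
      ring
    rw [h8, ← mul_assoc]
    exact mul_le_mul_of_nonneg_right h5.le hP.le
  have hup2 := partSum_le hx hB n
  set J := Finset.Icc B n
  have hJ : ∀ j ∈ J, j ≤ n := fun j hj => (Finset.mem_Icc.1 hj).2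
  -- A part of size at least (ν - δ)N: its intensity has the right constant up to ε/4, and the
  -- remainders together have at most the total mass.
  have hlarge : ∑ j ∈ J.filter (fun j : ℕ => (ν - δ) * N ≤ j),
      intensity p q N j * partSum (intensity p q N) (n - j)
      ≤ (A * ν ^ (-(s + 1)) + ε / 4) * (N : ℝ) ^ (-s) * T := by
    have h7 : ∀ j ∈ J.filter (fun j : ℕ => (ν - δ) * N ≤ j),
        intensity p q N j * partSum (intensity p q N) (n - j)
        ≤ (A * ν ^ (-(s + 1)) + ε / 4) * (N : ℝ) ^ (-s)
          * partSum (intensity p q N) (n - j) := by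
      intro j hj
      refine mul_le_mul_of_nonneg_right ?_ (partSum_nonneg hx _)
      refine (h4 j (Finset.mem_filter.1 hj).2).trans (mul_le_mul_of_nonneg_right ?_ hP.le)
      exact hup.le
    refine (Finset.sum_le_sum h7).trans ?_
    rw [← Finset.mul_sum, sum_sub_eq_sum_image fun j hj => hJ j (Finset.mem_filter.1 hj).1]
    refine mul_le_mul_of_nonneg_left (h.sum_partSum_le_totalMass fun m hm => ?_) (by positivity)
    obtain ⟨j, -, rfl⟩ := Finset.mem_image.1 hm
    omega
  -- A part between bN and (ν - δ)N: its intensity is still O(N^{-s}), but the remainder exceeds (μ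
  -- + δ/2)N, which is atypical.
  have hmedium : ∑ j ∈ J.filter (fun j : ℕ => ¬ (ν - δ) * N ≤ j),
      intensity p q N j * partSum (intensity p q N) (n - j) ≤ ε / 4 * (N : ℝ) ^ (-s) * T := by
    have h7 : ∀ j ∈ J.filter (fun j : ℕ => ¬ (ν - δ) * N ≤ j),
        intensity p q N j * partSum (intensity p q N) (n - j)
        ≤ K * (N : ℝ) ^ (-s) * partSum (intensity p q N) (n - j) := by
      intro j hj
      refine mul_le_mul_of_nonneg_right (h3 j ?_) (partSum_nonneg hx _)
      exact Nat.ceil_le.1 (Finset.mem_Icc.1 (Finset.mem_filter.1 hj).1).1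
    refine (Finset.sum_le_sum h7).trans ?_
    rw [← Finset.mul_sum, sum_sub_eq_sum_image fun j hj => hJ j (Finset.mem_filter.1 hj).1]
    refine (mul_le_mul_of_nonneg_left (h2 _ fun m hm => ?_) (by positivity)).trans (le_of_eq ?_)
    · obtain ⟨j, hj, rfl⟩ := Finset.mem_image.1 hm
      obtain ⟨hj1, hj2⟩ := Finset.mem_filter.1 hj
      refine ⟨by omega, le_trans ?_ (le_abs_self _)⟩
      rw [Nat.cast_sub (hJ j hj1), hncast]
      have : (ν - δ) * N = N - μ * N - δ * N := by rw [hν]; ring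
      linarith
    · field_simp
  rw [← Finset.sum_filter_add_sum_filter_not J (fun j : ℕ => (ν - δ) * N ≤ j)] at hup2
  have : 0 < ε / 4 * (N : ℝ) ^ (-s) * T := by positivity
  linarith

/-- The indices of parts of `N - k` close to `(1 - μ) N`. -/
noncomputable def window (μ b δ : ℝ) (k N : ℕ) : Finset ℕ :=
  (Finset.Icc ⌈b * (N : ℝ)⌉₊ (N - k)).filter fun j : ℕ => |(j : ℝ) - (1 - μ) * N| ≤ δ * N

/-- Lower bound for the contribution of one big part. -/
theorem le_sum_window (h : HeavyTailed p q s A μ) (k : ℕ) {b δ ε : ℝ} (hb : 0 < b)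
    (hbν : b < 1 - μ) (hb1 : b ≤ 1) (hδ : 0 < δ) (hε : 0 < ε) :
    ∀ᶠ N : ℕ in atTop, (A * (1 - μ) ^ (-(s + 1)) - ε) * (N : ℝ) ^ (-s) * totalMass p q N
      ≤ ∑ j ∈ window μ b δ k N, intensity p q N j
          * partSum (trunc (intensity p q N) ⌈b * (N : ℝ)⌉₊) (N - k - j) := by
  have hA := h.pos
  have hs := h.one_lt
  set ν := 1 - μ with hν
  have hν0 : 0 < ν := by rw [hν]; linarith [h.lt_one]
  obtain ⟨η, hη, hη'⟩ := h.exists_pos_const_mul_rpow_neg (show 0 < ε / 2 by linarith)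
  -- The four bounds control, in order, the constant in the intensity, the inclusion of the window
  -- above bN, its inclusion in the given window, and the condition that remainders near μN be at
  -- most N - k.
  set δ' := min (min η (ν - b)) (min δ ν) with hδ'
  have hδ0 : 0 < δ' := lt_min (lt_min hη (by linarith)) (lt_min hδ hν0)
  have hδη : δ' ≤ η := (min_le_left _ _).trans (min_le_left _ _)
  have hδb : δ' ≤ ν - b := (min_le_left _ _).trans (min_le_right _ _)
  have hδδ : δ' ≤ δ := (min_le_right _ _).trans (min_le_left _ _)
  have hδν : δ' ≤ ν := (min_le_right _ _).trans (min_le_right _ _)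
  have hlow := (hη' (-η) δ' (by rw [abs_neg, abs_of_pos hη]) (by rwa [abs_of_pos hδ0])).1
  rw [← hν] at hlow
  set D := A * ν ^ (-(s + 1)) with hD
  have hD0 : 0 < D := by positivity
  have e1 := h.le_sum_partSum_trunc_near hb hb1 (half_pos hδ0)
    (show 0 < min 1 (ε / (2 * D)) from lt_min one_pos (by positivity))
  have e2 := h.le_intensity hη hb (show 0 < ν + δ' by linarith)
  have e6 := (tendsto_natCast_atTop_atTop (R := ℝ)).const_mul_atTop (half_pos hδ0)
  filter_upwards [e1, e2, e6.eventually_ge_atTop (k : ℝ), eventually_ge_atTop 1,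
    eventually_ge_atTop k] with N h1 h2 h6 hN hkN
  have hN0 : (0 : ℝ) < N := by exact_mod_cast hN
  have hT := totalMass_pos p q N
  have hx := h.intensity_nonneg N
  set B := ⌈b * (N : ℝ)⌉₊
  set T := totalMass p q N
  have hncast : ((N - k : ℕ) : ℝ) = N - k := Nat.cast_sub hkN
  have hP : 0 < (N : ℝ) ^ (-s) := by positivity
  have hsub : window μ b δ' k N ⊆ window μ b δ k N := fun j hj => by
    rw [window, Finset.mem_filter] at hj ⊢
    exact ⟨hj.1, hj.2.trans (mul_le_mul_of_nonneg_right hδδ hN0.le)⟩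
  have hle : ∀ j ∈ window μ b δ' k N, j ≤ N - k := fun j hj =>
    (Finset.mem_Icc.1 (Finset.mem_filter.1 hj).1).2
  -- The remainders N - k - j fill the δ'N/2-neighbourhood of μN; the other half of δ'N absorbs the
  -- shift k.
  have h3 := h1 ((window μ b δ' k N).image (N - k - ·)) fun m hm => by
    by_contra hlt
    push Not at hlt
    refine hm (Finset.mem_image.2 ?_)
    have hab := abs_lt.1 hlt
    have hmn : m ≤ N - k := by
      have : (m : ℝ) ≤ ((N - k : ℕ) : ℝ) := by
        rw [hncast]
        have : μ * N = N - ν * N := by rw [hν]; ring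
        nlinarith
      exact_mod_cast this
    refine ⟨N - k - m, ?_, Nat.sub_sub_self hmn⟩
    have hk0 : (0 : ℝ) ≤ k := Nat.cast_nonneg k
    have hcast : ((N - k - m : ℕ) : ℝ) = N - k - m := by rw [Nat.cast_sub hmn, hncast]
    have hνN : (1 - μ) * N = N - μ * N := by ring
    rw [window, Finset.mem_filter, Finset.mem_Icc, hcast, hνN]
    refine ⟨⟨Nat.ceil_le.2 ?_, Nat.sub_le _ _⟩, abs_le.2 ⟨by linarith, by linarith⟩⟩
    rw [hcast]
    have : b * N ≤ (ν - δ') * N := mul_le_mul_of_nonneg_right (by linarith) hN0.le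
    have : (ν - δ') * N = N - μ * N - δ' * N := by rw [hν]; ring
    linarith
  rw [← sum_sub_eq_sum_image hle] at h3
  have h4 : ∑ j ∈ window μ b δ' k N, intensity p q N j
        * partSum (trunc (intensity p q N) B) (N - k - j)
      ≤ ∑ j ∈ window μ b δ k N, intensity p q N j
        * partSum (trunc (intensity p q N) B) (N - k - j) :=
    Finset.sum_le_sum_of_subset_of_nonneg hsub fun j _ _ =>
      mul_nonneg (hx j) (partSum_nonneg (trunc_nonneg hx B) _)
  refine le_trans ?_ h4
  -- The multiplicative estimate below needs D - ε/2 ≥ 0; if D ≤ ε the claimed bound is nonpositive.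
  rcases le_or_gt (D - ε) 0 with hneg | hpos
  · refine (mul_nonpos_of_nonpos_of_nonneg (mul_nonpos_of_nonpos_of_nonneg hneg hP.le)
      hT.le).trans (Finset.sum_nonneg fun j _ =>
        mul_nonneg (hx j) (partSum_nonneg (trunc_nonneg hx B) _))
  have h5 : ∀ j ∈ window μ b δ' k N,
      (D - ε / 2) * (N : ℝ) ^ (-s) * partSum (trunc (intensity p q N) B) (N - k - j)
      ≤ intensity p q N j * partSum (trunc (intensity p q N) B) (N - k - j) := by
    intro j hj
    refine mul_le_mul_of_nonneg_right ?_ (partSum_nonneg (trunc_nonneg hx B) _)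
    obtain ⟨hj1, hj2⟩ := Finset.mem_filter.1 hj
    refine le_trans (mul_le_mul_of_nonneg_right hlow.le hP.le)
      (h2 j (Nat.ceil_le.1 (Finset.mem_Icc.1 hj1).1) ?_)
    have := (abs_le.1 hj2).2
    rw [← hν] at this
    linarith
  refine le_trans ?_ (Finset.sum_le_sum h5)
  rw [← Finset.mul_sum]
  refine le_trans ?_ (mul_le_mul_of_nonneg_left h3
    (mul_nonneg (by linarith) hP.le))
  have h7 : D - ε ≤ (D - ε / 2) * (1 - min 1 (ε / (2 * D))) := by
    have h8 : min 1 (ε / (2 * D)) ≤ ε / (2 * D) := min_le_right _ _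
    have h9 : D * (ε / (2 * D)) = ε / 2 := by field_simp
    have h10 : 0 < min 1 (ε / (2 * D)) := lt_min one_pos (by positivity)
    nlinarith
  calc (D - ε) * (N : ℝ) ^ (-s) * T
      ≤ (D - ε / 2) * (1 - min 1 (ε / (2 * D))) * (N : ℝ) ^ (-s) * T :=
        mul_le_mul_of_nonneg_right (mul_le_mul_of_nonneg_right h7 hP.le) hT.le
    _ = _ := by ring

theorem sum_window_le_partSum (h : HeavyTailed p q s A μ) (k : ℕ) {b δ : ℝ} {N : ℕ}
    (hB : 1 ≤ ⌈b * (N : ℝ)⌉₊) :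
    ∑ j ∈ window μ b δ k N, intensity p q N j
      * partSum (trunc (intensity p q N) ⌈b * (N : ℝ)⌉₊) (N - k - j)
      ≤ partSum (intensity p q N) (N - k) := by
  simpa [partSum, window] using sum_mul_partSum_trunc_le (h.intensity_nonneg N) hB
    (Finset.filter_subset _ _) (fun _ => 1) (fun _ => zero_le_one) (fun _ _ _ _ _ => le_rfl)

theorem exists_pos_lt_window (h : HeavyTailed p q s A μ) : ∃ b : ℝ, 0 < b ∧ b < 1 - μ ∧ b ≤ 1 := by
  have := h.lt_one
  refine ⟨min 1 ((1 - μ) / 2), lt_min one_pos (by linarith), ?_, min_le_left _ _⟩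
  have := min_le_right 1 ((1 - μ) / 2)
  linarith

/-- The two one-big-part bounds coincide. The limit does not depend on k, since a bounded shift is
invisible at scale N. -/
theorem tendsto_partSum_sub_div (h : HeavyTailed p q s A μ) (k : ℕ) :
    Tendsto (fun N : ℕ => partSum (intensity p q N) (N - k)
      / ((N : ℝ) ^ (-s) * totalMass p q N)) atTop (𝓝 (A * (1 - μ) ^ (-(s + 1)))) := by
  obtain ⟨b, hb, hbν, hb1⟩ := h.exists_pos_lt_window
  refine tendsto_order.2 ⟨fun a ha => ?_, fun a ha => ?_⟩
  · filter_upwards [h.le_sum_window k hb hbν hb1 one_pos (half_pos (sub_pos.2 ha)),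
      eventually_ge_atTop 1] with N h1 hN
    have hN0 : (0 : ℝ) < N := by exact_mod_cast hN
    have hT := totalMass_pos p q N
    have h2 := h.sum_window_le_partSum k (δ := 1) (ceil_mul_bounds hb hb1 hN).1
    rw [lt_div_iff₀ (by positivity)]
    have h3 : 0 < (N : ℝ) ^ (-s) * totalMass p q N := by positivity
    nlinarith
  · filter_upwards [h.partSum_sub_le k (half_pos (sub_pos.2 ha)),
      eventually_ge_atTop 1] with N h1 hN
    have hN0 : (0 : ℝ) < N := by exact_mod_cast hN
    have hT := totalMass_pos p q N
    rw [div_lt_iff₀ (by positivity)]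
    have h3 : 0 < (N : ℝ) ^ (-s) * totalMass p q N := by positivity
    nlinarith

theorem limit_pos (h : HeavyTailed p q s A μ) : 0 < A * (1 - μ) ^ (-(s + 1)) := by
  have := h.pos
  have : 0 < 1 - μ := by linarith [h.lt_one]
  positivity

theorem eventually_partSum_pos (h : HeavyTailed p q s A μ) :
    ∀ᶠ N : ℕ in atTop, 0 < partSum (intensity p q N) N := by
  filter_upwards [(tendsto_order.1 (h.tendsto_partSum_sub_div 0)).1 0 h.limit_pos] with N h1
  by_contra h2
  refine absurd h1 (not_lt.2 (div_nonpos_of_nonpos_of_nonneg (not_lt.1 h2) ?_))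
  have := totalMass_pos p q N
  positivity

theorem tendsto_partSum_ratio (h : HeavyTailed p q s A μ) (k : ℕ) :
    Tendsto (fun N : ℕ => partSum (intensity p q N) (N - k) / partSum (intensity p q N) N)
      atTop (𝓝 1) := by
  have h1 := (h.tendsto_partSum_sub_div k).div (h.tendsto_partSum_sub_div 0) h.limit_pos.ne'
  rw [div_self h.limit_pos.ne'] at h1
  refine h1.congr' ?_
  filter_upwards [eventually_ge_atTop 1] with N hN
  have hN0 : (0 : ℝ) < N := by exact_mod_cast hN
  have hT := totalMass_pos p q N
  have h3 : (N : ℝ) ^ (-s) * totalMass p q N ≠ 0 := by positivity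
  rw [Pi.div_apply, Nat.sub_zero, div_div_div_cancel_right₀ h3]

/-- Asymptotically all the weight is carried by the partitions with one part close to
`(1 - μ) N` and all other parts smaller than `b N`. -/
theorem eventually_le_sum_window_div (h : HeavyTailed p q s A μ) {b δ ε : ℝ} (hb : 0 < b)
    (hbν : b < 1 - μ) (hb1 : b ≤ 1) (hδ : 0 < δ) (hε : 0 < ε) :
    ∀ᶠ N : ℕ in atTop, 1 - ε ≤ (∑ j ∈ window μ b δ 0 N, intensity p q N j
      * partSum (trunc (intensity p q N) ⌈b * (N : ℝ)⌉₊) (N - j))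
      / partSum (intensity p q N) N := by
  have hD := h.limit_pos
  set D := A * (1 - μ) ^ (-(s + 1)) with hDdef
  -- Keeps 1 - ε₀ nonnegative; the loss then closes by (1 - ε₀)(1 + ε₀/2) ≤ 1 - ε₀/2.
  set ε₀ := min ε 1 with hε₀
  have hε0 : 0 < ε₀ := lt_min hε one_pos
  have hε1 : ε₀ ≤ 1 := min_le_right _ _
  have hεε : ε₀ ≤ ε := min_le_left _ _
  have hε' : 0 < ε₀ * D / 2 := by positivity
  filter_upwards [h.le_sum_window 0 hb hbν hb1 hδ hε', h.partSum_sub_le 0 hε',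
    h.eventually_partSum_pos, eventually_ge_atTop 1] with N h1 h2 h3 hN
  have hN0 : (0 : ℝ) < N := by exact_mod_cast hN
  have hT := totalMass_pos p q N
  rw [le_div_iff₀ h3]
  simp only [Nat.sub_zero] at h1 h2
  refine le_trans ?_ h1
  rw [← hDdef] at h2 ⊢
  have hP : 0 < (N : ℝ) ^ (-s) * totalMass p q N := by positivity
  calc (1 - ε) * partSum (intensity p q N) N
      ≤ (1 - ε₀) * partSum (intensity p q N) N := mul_le_mul_of_nonneg_right (by linarith) h3.le
    _ ≤ (1 - ε₀) * ((D + ε₀ * D / 2) * (N : ℝ) ^ (-s) * totalMass p q N) :=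
        mul_le_mul_of_nonneg_left h2 (by linarith)
    _ = (1 - ε₀) * (D + ε₀ * D / 2) * ((N : ℝ) ^ (-s) * totalMass p q N) := by ring
    _ ≤ (D - ε₀ * D / 2) * ((N : ℝ) ^ (-s) * totalMass p q N) := by
        refine mul_le_mul_of_nonneg_right ?_ hP.le
        nlinarith [mul_pos hε0 hD, mul_pos hε0 (mul_pos hε0 hD)]
    _ = _ := by ring

end HeavyTailed

/-! ## Coefficients of functions with an algebraic singularity -/

theorem iteratedDeriv_comp_mul_left (c : ℂ) (f : ℂ → ℂ) (n : ℕ) (z : ℂ) :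
    iteratedDeriv n (fun z => f (c * z)) z = c ^ n * iteratedDeriv n f (c * z) := by
  induction n generalizing z with
  | zero => simp
  | succ n ih =>
    rw [iteratedDeriv_succ, funext ih, iteratedDeriv_succ, deriv_const_mul_field,
      deriv_comp_mul_left, smul_eq_mul, pow_succ, mul_assoc]

theorem iteratedDeriv_iteratedDeriv (m n : ℕ) (f : ℂ → ℂ) :
    iteratedDeriv m (iteratedDeriv n f) = iteratedDeriv (m + n) f := by
  rw [iteratedDeriv_eq_iterate, iteratedDeriv_eq_iterate, iteratedDeriv_eq_iterate,
    Function.iterate_add_apply]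

theorem iteratedDeriv_eq_of_hasFPowerSeriesAt {f : ℂ → ℂ} {c : ℕ → ℂ}
    (h : HasFPowerSeriesAt f (FormalMultilinearSeries.ofScalars ℂ c) 0) (m : ℕ) :
    iteratedDeriv m f 0 = m.factorial * c m := by
  obtain ⟨r, hr⟩ := h
  have h1 := hr.factorial_smul 1 m
  rw [iteratedDeriv_eq_iteratedFDeriv, ← h1, nsmul_eq_mul]
  congr 1
  simp [FormalMultilinearSeries.ofScalars]

/-- The Poisson kernel (1 - ρ²) / |e^{iθ} - ρ|² has circle average 1, and |e^{iθ} - ρ| = |1 - ρ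
e^{iθ}| by conjugation and rotation. -/
theorem circleAverage_inv_norm_sq {ρ : ℝ} (h0 : 0 ≤ ρ) (h1 : ρ < 1) :
    (2 * Real.pi)⁻¹ * ∫ θ in (0 : ℝ)..2 * Real.pi, (‖1 - circleMap 0 ρ θ‖ ^ 2)⁻¹
      = (1 - ρ ^ 2)⁻¹ := by
  have h2 : (ρ : ℂ) ∈ Metric.ball (0 : ℂ) 1 := by
    rw [mem_ball_zero_iff, Complex.norm_real, Real.norm_of_nonneg h0]
    exact h1
  have h3 := (diffContOnCl_const (c := (1 : ℝ) • (1 : ℂ))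
    (s := Metric.ball (0 : ℂ) 1)).circleAverage_poissonKernel_smul' h2
  have h4 : ∀ θ : ℝ, ‖circleMap 0 1 θ - (ρ : ℂ)‖ = ‖1 - circleMap 0 ρ θ‖ := by
    intro θ
    have h5 : ‖circleMap 0 1 (-θ)‖ = 1 := by simp
    have h6 : circleMap 0 1 θ * circleMap 0 1 (-θ) = 1 := by
      simp only [circleMap, zero_add, Complex.ofReal_one, one_mul]
      rw [← Complex.exp_add]
      simp
    have h7 : circleMap 0 ρ θ = ρ * circleMap 0 1 θ := by simp [circleMap]
    have h8 : (starRingEnd ℂ) (1 - circleMap 0 ρ θ)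
        = circleMap 0 1 (-θ) * (circleMap 0 1 θ - ρ) := by
      rw [h7, mul_sub, mul_comm (circleMap 0 1 (-θ)), h6, map_sub, map_one, map_mul,
        Complex.conj_ofReal, mul_comm (circleMap 0 1 (-θ))]
      congr 2
      simp only [circleMap, zero_add, Complex.ofReal_one, one_mul]
      rw [← Complex.exp_conj]
      simp
    rw [← Complex.norm_conj (1 - circleMap 0 ρ θ), h8, norm_mul, h5, one_mul]
  have h9 : (2 * Real.pi)⁻¹ * ∫ θ in (0 : ℝ)..2 * Real.pi,
      (1 - ρ ^ 2) * (‖1 - circleMap 0 ρ θ‖ ^ 2)⁻¹ = 1 := by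
    rw [Real.circleAverage_def] at h3
    have h10 : ∀ θ : ℝ, ((‖circleMap 0 1 θ - 0‖ ^ 2 - ‖(ρ : ℂ) - 0‖ ^ 2)
        / ‖circleMap 0 1 θ - 0 - ((ρ : ℂ) - 0)‖ ^ 2) • ((1 : ℝ) • (1 : ℂ))
        = (((1 - ρ ^ 2) * (‖1 - circleMap 0 ρ θ‖ ^ 2)⁻¹ : ℝ) : ℂ) := by
      intro θ
      rw [sub_zero, sub_zero, h4]
      simp [div_eq_mul_inv]
    simp only [h10] at h3
    rw [intervalIntegral.integral_ofReal] at h3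
    have h11 := congrArg Complex.re h3
    simpa [← Complex.ofReal_pow] using h11
  have h12 : 1 - ρ ^ 2 ≠ 0 := by nlinarith
  rw [intervalIntegral.integral_const_mul] at h9
  field_simp
  field_simp at h9
  linarith

/-- Cauchy estimate for functions which are `O(|1 - z|^{-γ})` in the unit disk. -/
theorem norm_coeff_le_of_norm_le_rpow {f : ℂ → ℂ} {K γ : ℝ} (hγ : 2 ≤ γ)
    (hf : DifferentiableOn ℂ f (Metric.ball 0 1))
    (hK : ∀ z ∈ Metric.ball (0 : ℂ) 1, ‖f z‖ ≤ K * ‖1 - z‖ ^ (-γ)) {m : ℕ} (hm : 1 ≤ m) :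
    ‖iteratedDeriv m f 0 / m.factorial‖ ≤ 2 * K * (2 * m : ℝ) ^ (γ - 1) := by
  have hm' : (1 : ℝ) ≤ m := by exact_mod_cast hm
  have hK0 : 0 ≤ K := by
    have := (norm_nonneg _).trans (hK 0 (by simp))
    rwa [sub_zero, norm_one, Real.one_rpow, mul_one] at this
  set ρ : ℝ := 1 - 1 / (2 * m) with hρ
  have hi : 1 / (2 * (m : ℝ)) ≤ 1 / 2 := by
    apply one_div_le_one_div_of_le <;> linarith
  have hi0 : 0 < 1 / (2 * (m : ℝ)) := by positivity
  have hρ0 : 0 < ρ := by rw [hρ]; linarith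
  have hρ1 : ρ < 1 := by rw [hρ]; linarith
  have hsub : Metric.closedBall (0 : ℂ) ρ ⊆ Metric.ball 0 1 :=
    Metric.closedBall_subset_ball hρ1
  lift ρ to NNReal using hρ0.le with ρ' hρ'
  have hps := (hf.mono hsub).hasFPowerSeriesOnBall (R := ρ') (by exact_mod_cast hρ0)
  have h1 := hps.factorial_smul 1 m
  rw [← iteratedDeriv_eq_iteratedFDeriv, nsmul_eq_mul] at h1
  have hfac : (m.factorial : ℂ) ≠ 0 := by exact_mod_cast m.factorial_ne_zero
  rw [← h1, mul_div_cancel_left₀ _ hfac]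
  have h2 : ‖(cauchyPowerSeries f 0 ρ' m) fun _ => (1 : ℂ)‖ ≤ ‖cauchyPowerSeries f 0 ρ' m‖ := by
    simp
  refine h2.trans ((norm_cauchyPowerSeries_le f 0 ρ' m).trans ?_)
  have h3 : |(ρ' : ℝ)|⁻¹ ^ m ≤ 2 := by
    rw [abs_of_pos hρ0, inv_pow]
    refine inv_le_of_inv_le₀ (by norm_num) ?_
    have h4 := one_add_mul_le_pow (show (-2 : ℝ) ≤ -(1 / (2 * m)) by linarith) m
    have h5 : (1 : ℝ) + -(1 / (2 * m)) = ρ' := by rw [hρ]; ring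
    have h6 : (1 : ℝ) + m * -(1 / (2 * m)) = 2⁻¹ := by field_simp; norm_num
    rwa [h5, h6] at h4
  have hmem : ∀ θ : ℝ, circleMap 0 (ρ' : ℝ) θ ∈ Metric.ball (0 : ℂ) 1 := fun θ =>
    hsub (Metric.sphere_subset_closedBall (circleMap_mem_sphere 0 hρ0.le θ))
  have hlow : ∀ θ : ℝ, 1 / (2 * (m : ℝ)) ≤ ‖1 - circleMap 0 (ρ' : ℝ) θ‖ := by
    intro θ
    have h4 := norm_sub_norm_le (1 : ℂ) (circleMap 0 (ρ' : ℝ) θ)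
    have h5 : ‖circleMap 0 (ρ' : ℝ) θ‖ = ρ' := by
      rw [norm_circleMap_zero, abs_of_pos hρ0]
    rw [h5, norm_one] at h4
    linarith
  -- Of the γ powers of |1 - z|^{-1}, γ - 2 are bounded pointwise by 2m. The remaining two are
  -- integrated exactly and cost only one factor 2m instead of two; this is where γ ≥ 2 enters.
  have hpt : ∀ θ : ℝ, ‖f (circleMap 0 ρ' θ)‖
      ≤ K * (2 * m : ℝ) ^ (γ - 2) * (‖1 - circleMap 0 (ρ' : ℝ) θ‖ ^ 2)⁻¹ := by
    intro θ
    refine (hK _ (hmem θ)).trans ?_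
    set w := ‖1 - circleMap 0 (ρ' : ℝ) θ‖ with hw
    have hw0 : 0 < w := hi0.trans_le (hlow θ)
    rw [mul_assoc]
    refine mul_le_mul_of_nonneg_left ?_ hK0
    have h4 : w ^ (-γ) = w ^ (-(γ - 2)) * (w ^ 2)⁻¹ := by
      rw [← Real.rpow_natCast, ← Real.rpow_neg hw0.le, ← Real.rpow_add hw0]
      congr 1
      push_cast
      ring
    rw [h4]
    refine mul_le_mul_of_nonneg_right ?_ (by positivity)
    have h5 : (2 * m : ℝ) ^ (γ - 2) = (1 / (2 * m) : ℝ) ^ (-(γ - 2)) := by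
      rw [one_div, Real.inv_rpow (by positivity), Real.rpow_neg (by positivity), inv_inv]
    rw [h5]
    exact Real.rpow_le_rpow_of_nonpos hi0 (hlow θ) (by linarith)
  have hcf : Continuous fun θ : ℝ => ‖f (circleMap 0 ρ' θ)‖ :=
    (hf.continuousOn.comp_continuous (continuous_circleMap 0 _) hmem).norm
  have hcg : Continuous fun θ : ℝ =>
      K * (2 * m : ℝ) ^ (γ - 2) * (‖1 - circleMap 0 (ρ' : ℝ) θ‖ ^ 2)⁻¹ := by
    refine continuous_const.mul (Continuous.inv₀ ?_ fun θ => ?_)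
    · exact ((continuous_const.sub (continuous_circleMap 0 _)).norm).pow 2
    · have := hi0.trans_le (hlow θ)
      positivity
  have h7 : (2 * Real.pi)⁻¹ * ∫ θ in (0 : ℝ)..2 * Real.pi, ‖f (circleMap 0 ρ' θ)‖
      ≤ K * (2 * m : ℝ) ^ (γ - 1) := by
    have h8 := intervalIntegral.integral_mono_on (μ := MeasureTheory.volume)
      Real.two_pi_pos.le (hcf.intervalIntegrable _ _)
      (hcg.intervalIntegrable _ _) fun θ _ => hpt θ
    rw [intervalIntegral.integral_const_mul] at h8
    have h9 := mul_le_mul_of_nonneg_left h8 (inv_nonneg.2 Real.two_pi_pos.le)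
    rw [mul_left_comm, circleAverage_inv_norm_sq hρ0.le hρ1] at h9
    refine h9.trans ?_
    have h10 : (1 - (ρ' : ℝ) ^ 2)⁻¹ ≤ (2 * m : ℝ) := by
      refine inv_le_of_inv_le₀ (by positivity) ?_
      have : (2 * (m : ℝ))⁻¹ = 1 - ρ' := by rw [hρ]; ring
      rw [this]
      nlinarith
    have h11 : (2 * m : ℝ) ^ (γ - 1) = (2 * m : ℝ) ^ (γ - 2) * (2 * m) := by
      rw [← Real.rpow_add_one (by positivity)]
      congr 1
      ring
    rw [h11, ← mul_assoc]
    exact mul_le_mul_of_nonneg_left h10 (by positivity)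
  calc _ ≤ K * (2 * m : ℝ) ^ (γ - 1) * 2 := mul_le_mul h7 h3 (by positivity) (by positivity)
    _ = _ := by ring

theorem factorial_mul_choose_eq_prod (β : ℝ) (m : ℕ) :
    (m.factorial : ℝ) * Ring.choose (β + m - 1) m = ∏ i ∈ Finset.range m, (β + i) := by
  have h : (ascPochhammer ℝ m).eval β = ∏ i ∈ Finset.range m, (β + i) := by
    induction m with
    | zero => simp
    | succ m ih => rw [ascPochhammer_succ_eval, ih, Finset.prod_range_succ]
  rw [← h, ← Polynomial.ascPochhammer_smeval_eq_eval,
    ← Ring.factorial_nsmul_multichoose_eq_ascPochhammer, nsmul_eq_mul, Ring.choose]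
  congr 2
  ring

/-- Euler's limit formula for the Gamma function, as these binomial coefficients are rising
factorials of β divided by m!. -/
theorem tendsto_choose_mul_rpow {β : ℝ} (hβ : 0 < β) :
    Tendsto (fun m : ℕ => Ring.choose (β + m - 1) m * (m : ℝ) ^ (1 - β)) atTop
      (𝓝 (Real.Gamma β)⁻¹) := by
  have h1 := (Real.GammaSeq_tendsto_Gamma β).inv₀ (Real.Gamma_pos_of_pos hβ).ne'
  have h2 : Tendsto (fun m : ℕ => (m : ℝ) / (m + β)) atTop (𝓝 1) := by
    simpa using tendsto_natCast_div_add_atTop β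
  have h3 := h1.mul h2
  rw [mul_one] at h3
  refine h3.congr' ?_
  filter_upwards [eventually_ge_atTop 1] with m hm
  have hm0 : (0 : ℝ) < m := by exact_mod_cast hm
  have h4 := factorial_mul_choose_eq_prod β m
  have hf : (m.factorial : ℝ) ≠ 0 := by positivity
  rw [Real.GammaSeq, Finset.prod_range_succ, ← h4, inv_div, Real.rpow_sub hm0, Real.rpow_one]
  have h5 : (m : ℝ) ^ β ≠ 0 := by positivity
  have h6 : (m : ℝ) + β ≠ 0 := by positivity
  have h7 : β + (m : ℝ) ≠ 0 := by positivity
  field_simp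
  ring

/-- Transfer of an algebraic singularity at `1` to the coefficients. -/
theorem tendsto_coeff_mul_rpow {f : ℂ → ℂ} {c : ℕ → ℝ} {L K β γ : ℝ} (hβ : 0 < β) (hγ : 2 ≤ γ)
    (hγβ : γ < β) (hf : DifferentiableOn ℂ f (Metric.ball 0 1))
    (hc : ∀ m, iteratedDeriv m f 0 = m.factorial * c m)
    (hK : ∀ z ∈ Metric.ball (0 : ℂ) 1,
      ‖f z - L * (1 - z) ^ ((-β : ℝ) : ℂ)‖ ≤ K * ‖1 - z‖ ^ (-γ)) :
    Tendsto (fun m : ℕ => c m * (m : ℝ) ^ (1 - β)) atTop (𝓝 (L / Real.Gamma β)) := by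
  have hps := Complex.one_div_one_sub_cpow_hasFPowerSeriesOnBall_zero (β : ℂ)
  set h : ℂ → ℂ := fun x => 1 / (1 - x) ^ (β : ℂ) with hdef
  have hdiff : DifferentiableOn ℂ h (Metric.ball 0 1) := by
    have := hps.differentiableOn
    rwa [← ENNReal.coe_one, Metric.eball_coe] at this
  have hcoeff : ∀ m, iteratedDeriv m h 0 = m.factorial * (Ring.choose (β + m - 1) m : ℝ) := by
    intro m
    rw [iteratedDeriv_eq_of_hasFPowerSeriesAt hps.hasFPowerSeriesAt m, Complex.ofReal_choose]
    push_cast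
    rfl
  have hnhds : Metric.ball (0 : ℂ) 1 ∈ 𝓝 (0 : ℂ) := Metric.ball_mem_nhds _ one_pos
  -- The Cauchy estimate for the difference with L (1 - z)^{-β}: its coefficients are O(m^{γ-1}),
  -- hence o(m^{β-1}).
  have hbound : ∀ m : ℕ, 1 ≤ m → |c m - L * Ring.choose (β + m - 1) m|
      ≤ 2 * K * (2 * m : ℝ) ^ (γ - 1) := by
    intro m hm
    have h1 := norm_coeff_le_of_norm_le_rpow (f := fun z => f z - L * h z) (K := K) hγ
      (hf.sub (hdiff.const_mul _)) (fun z hz => by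
        have := hK z hz
        rwa [Complex.ofReal_neg, Complex.cpow_neg, ← one_div] at this) hm
    have h2 : iteratedDeriv m (fun z => f z - L * h z) 0
        = iteratedDeriv m f 0 - L * iteratedDeriv m h 0 := by
      have h3 := iteratedDeriv_sub (n := m) (x := (0 : ℂ)) (f := f) (g := fun z => L * h z)
        (hf.analyticAt hnhds).contDiffAt ((hdiff.const_mul _).analyticAt hnhds).contDiffAt
      rw [iteratedDeriv_const_mul_field] at h3
      exact h3
    have hfac : (m.factorial : ℂ) ≠ 0 := by exact_mod_cast m.factorial_ne_zero
    have h4 : iteratedDeriv m (fun z => f z - L * h z) 0 / m.factorial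
        = ((c m - L * Ring.choose (β + m - 1) m : ℝ) : ℂ) := by
      rw [h2, hc, hcoeff]
      push_cast
      field_simp
    rwa [h4, Complex.norm_real, Real.norm_eq_abs] at h1
  have h5 : Tendsto (fun m : ℕ => (c m - L * Ring.choose (β + m - 1) m) * (m : ℝ) ^ (1 - β))
      atTop (𝓝 0) := by
    have h6 : Tendsto (fun m : ℕ => 2 * K * 2 ^ (γ - 1) * (m : ℝ) ^ (-(β - γ))) atTop (𝓝 0) := by
      simpa using ((tendsto_rpow_neg_atTop (sub_pos.2 hγβ)).comp
        tendsto_natCast_atTop_atTop).const_mul (2 * K * 2 ^ (γ - 1))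
    refine squeeze_zero_norm' ?_ h6
    filter_upwards [eventually_ge_atTop 1] with m hm
    have hm0 : (0 : ℝ) < m := by exact_mod_cast hm
    rw [norm_mul, Real.norm_eq_abs, Real.norm_of_nonneg (by positivity)]
    refine (mul_le_mul_of_nonneg_right (hbound m hm) (by positivity)).trans (le_of_eq ?_)
    rw [Real.mul_rpow (by norm_num) hm0.le,
      show -(β - γ) = (γ - 1) + (1 - β) by ring, Real.rpow_add hm0]
    ring
  have h7 := h5.add ((tendsto_choose_mul_rpow hβ).const_mul L)
  rw [zero_add, ← div_eq_mul_inv] at h7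
  refine h7.congr fun m => ?_
  ring

theorem tendsto_factorial_ratio (n : ℕ) :
    Tendsto (fun m : ℕ => ((m + n).factorial : ℝ) / m.factorial * (m : ℝ) ^ (-(n : ℝ))) atTop
      (𝓝 1) := by
  induction n with
  | zero =>
    refine tendsto_const_nhds.congr fun m => ?_
    have : (m.factorial : ℝ) ≠ 0 := by positivity
    simp [div_self this]
  | succ n ih =>
    have h1 : Tendsto (fun m : ℕ => ((m : ℝ) + (n + 1)) / m) atTop (𝓝 1) := by
      have h2 : Tendsto (fun m : ℕ => 1 + ((n : ℝ) + 1) * (m : ℝ)⁻¹) atTop (𝓝 1) := by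
        simpa using ((tendsto_inv_atTop_zero.comp
          (tendsto_natCast_atTop_atTop (R := ℝ))).const_mul ((n : ℝ) + 1)).const_add 1
      refine h2.congr' ?_
      filter_upwards [eventually_ge_atTop 1] with m hm
      have hm0 : (m : ℝ) ≠ 0 := by positivity
      field_simp
    have h2 := ih.mul h1
    rw [mul_one] at h2
    refine h2.congr' ?_
    filter_upwards [eventually_ge_atTop 1] with m hm
    have hm0 : (0 : ℝ) < m := by exact_mod_cast hm
    rw [show m + (n + 1) = m + n + 1 from rfl, Nat.factorial_succ]
    push_cast
    rw [show -((n : ℝ) + 1) = -(n : ℝ) - 1 by ring, Real.rpow_sub_one hm0.ne']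
    ring

/-- Undoes n differentiations: the factor (m+n)!/m! is asymptotic to m^n. -/
theorem tendsto_of_tendsto_shift {p : ℕ → ℝ} {s A : ℝ} (n : ℕ)
    (h : Tendsto (fun m : ℕ => ((m + n).factorial : ℝ) / m.factorial * p (m + n)
      * (m : ℝ) ^ (1 - (n - s))) atTop (𝓝 A)) :
    Tendsto (fun j : ℕ => p j * (j : ℝ) ^ (s + 1)) atTop (𝓝 A) := by
  rw [← tendsto_add_atTop_iff_nat n]
  have h1 : Tendsto (fun m : ℕ => (((m + n : ℕ) : ℝ) / m) ^ (s + 1)) atTop (𝓝 1) := by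
    have h2 : Tendsto (fun m : ℕ => ((m + n : ℕ) : ℝ) / m) atTop (𝓝 1) := by
      have h2 : Tendsto (fun m : ℕ => 1 + (n : ℝ) * (m : ℝ)⁻¹) atTop (𝓝 1) := by
        simpa using ((tendsto_inv_atTop_zero.comp
          (tendsto_natCast_atTop_atTop (R := ℝ))).const_mul (n : ℝ)).const_add 1
      refine h2.congr' ?_
      filter_upwards [eventually_ge_atTop 1] with m hm
      have hm0 : (m : ℝ) ≠ 0 := by positivity
      push_cast
      field_simp
    simpa using h2.rpow_const (p := s + 1) (Or.inl one_ne_zero)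
  have h3 := (h.mul h1).div (tendsto_factorial_ratio n) one_ne_zero
  rw [mul_one, div_one] at h3
  refine h3.congr' ?_
  filter_upwards [eventually_ge_atTop 1] with m hm
  have hm0 : (0 : ℝ) < m := by exact_mod_cast hm
  have h4 : ((m + n).factorial : ℝ) ≠ 0 := by positivity
  have h5 : (m.factorial : ℝ) ≠ 0 := by positivity
  have h6 : (m : ℝ) ^ (1 - (n - s)) = (m : ℝ) ^ (-(n : ℝ)) * (m : ℝ) ^ (s + 1) := by
    rw [← Real.rpow_add hm0]
    congr 1
    ring
  have h7 : (m : ℝ) ^ (-(n : ℝ)) ≠ 0 := by positivity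
  have h8 : (m : ℝ) ^ (s + 1) ≠ 0 := by positivity
  rw [Pi.div_apply, h6, Real.div_rpow (by positivity) hm0.le]
  field_simp

/-! ## The generating functions in a neighbourhood of the disk -/

theorem lt_norm_radius {R η φ : ℝ} (hR : 0 < R) (hη : 0 < η)
    (hφ : φ ∈ Set.Ioo 0 (Real.pi / 2)) :
    R < ‖(R : ℂ) * (1 + η * Complex.exp (Complex.I * φ))‖ := by
  have hcos : 0 < Real.cos φ :=
    Real.cos_pos_of_mem_Ioo ⟨by linarith [hφ.1, Real.pi_pos], hφ.2⟩
  have h1 : (1 + η * Complex.exp (Complex.I * φ)).re = 1 + η * Real.cos φ := by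
    rw [mul_comm Complex.I, Complex.add_re, Complex.re_ofReal_mul, Complex.exp_ofReal_mul_I_re,
      Complex.one_re]
  have h2 : 1 < ‖1 + η * Complex.exp (Complex.I * φ)‖ := by
    refine lt_of_lt_of_le ?_ (Complex.re_le_norm _)
    rw [h1]
    have := mul_pos hη hcos
    linarith
  rw [norm_mul, Complex.norm_real, Real.norm_of_nonneg hR.le]
  nlinarith

/-- The part of a disk to the left of the vertical line through `R`. -/
def leftRegion (ρ R : ℝ) : Set ℂ := {z : ℂ | ‖z‖ < ρ ∧ z.re < R}

theorem isOpen_leftRegion (ρ R : ℝ) : IsOpen (leftRegion ρ R) :=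
  (isOpen_lt continuous_norm continuous_const).inter
    (isOpen_lt Complex.continuous_re continuous_const)

/-- Left of the vertical line through R the argument of z - R exceeds π/2 > φ in absolute value.
This half of Δ₀ contains the closed disk except R, which suffices for the transfer. -/
theorem leftRegion_subset_Delta0 {R η φ : ℝ} (hφ : φ ∈ Set.Ioo 0 (Real.pi / 2)) :
    leftRegion ‖(R : ℂ) * (1 + η * Complex.exp (Complex.I * φ))‖ R ⊆ Delta0 R η φ := by
  rintro z ⟨h1, h2⟩
  refine ⟨h1, ?_, ?_⟩
  · rintro rfl
    simp at h2
  · refine hφ.2.trans ?_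
    by_contra h
    have := Complex.abs_arg_le_pi_div_two_iff.1 (not_lt.1 h)
    simp only [Complex.sub_re, Complex.ofReal_re] at this
    linarith

theorem mem_leftRegion_of_norm_le {ρ R : ℝ} (hρ : R < ρ) {z : ℂ} (hz : ‖z‖ ≤ R)
    (hzR : z ≠ R) : z ∈ leftRegion ρ R := by
  refine ⟨hz.trans_lt hρ, lt_of_le_of_ne ((Complex.re_le_norm z).trans hz) fun h => hzR ?_⟩
  have h1 : Complex.normSq z ≤ R ^ 2 := by
    rw [Complex.normSq_eq_norm_sq]
    exact pow_le_pow_left₀ (norm_nonneg z) hz 2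
  rw [Complex.normSq_apply, h] at h1
  have h2 : z.im = 0 := by nlinarith [mul_self_nonneg z.im]
  exact Complex.ext (by simpa using h) (by simpa using h2)

theorem IsGenFunOn.iteratedDeriv_zero {c : ℕ → ℝ} {g : ℂ → ℂ} {U : Set ℂ}
    (h : IsGenFunOn c g U) (m : ℕ) :
    iteratedDeriv m g 0 = m.factorial * ((c m / m : ℝ) : ℂ) :=
  iteratedDeriv_eq_of_hasFPowerSeriesAt h.1 m

/-- Globalises the local expansion to the unit disk. Near 1 it is the expansion, with |z| ≥ 1/2 used
to cancel z^n. Away from 1, compactness bounds D, and |1 - z| ≤ 2 keeps the comparison function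
bounded below. -/
theorem exists_norm_sub_le_rpow {D : ℂ → ℂ} {R ρ e : ℝ} {L : ℝ} {β γ : ℝ} (n : ℕ) (hR : 0 < R)
    (hρ : R < ρ) (hγ0 : 0 ≤ γ) (hγβ : γ ≤ β) (he : -γ ≤ e)
    (hD : ContinuousOn D (leftRegion ρ R))
    (hO : (fun z : ℂ => z ^ n * D z - (z / R) ^ n * (L * (1 - z / R) ^ ((-β : ℝ) : ℂ)))
      =O[𝓝[leftRegion ρ R] (R : ℂ)] fun z : ℂ => ‖1 - z / (R : ℂ)‖ ^ e) :
    ∃ K : ℝ, ∀ z ∈ Metric.ball (0 : ℂ) 1,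
      ‖(R : ℂ) ^ n * D (R * z) - L * (1 - z) ^ ((-β : ℝ) : ℂ)‖ ≤ K * ‖1 - z‖ ^ (-γ) := by
  have hRC : (R : ℂ) ≠ 0 := by exact_mod_cast hR.ne'
  obtain ⟨C, hC⟩ := hO.bound
  obtain ⟨ε, hε, hball⟩ := Metric.mem_nhdsWithin_iff.1 hC
  set ε₁ := min (ε / R) (1 / 2) with hε₁
  have hε₁0 : 0 < ε₁ := lt_min (by positivity) (by norm_num)
  have hregion : ∀ z : ℂ, ‖z‖ ≤ 1 → z ≠ 1 → (R : ℂ) * z ∈ leftRegion ρ R := by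
    intro z hz hz1
    refine mem_leftRegion_of_norm_le hρ ?_ fun h => hz1 ?_
    · rw [norm_mul, Complex.norm_real, Real.norm_of_nonneg hR.le]
      exact mul_le_of_le_one_right hR.le hz
    · exact mul_left_cancel₀ hRC (h.trans (mul_one _).symm)
  set F : Set ℂ := Metric.closedBall 0 1 ∩ {z | ε₁ ≤ ‖1 - z‖} with hF
  have hFc : IsCompact F := (isCompact_closedBall _ _).inter_right
    (isClosed_le continuous_const (continuous_const.sub continuous_id).norm)
  have hcont : ContinuousOn (fun z : ℂ => (R : ℂ) ^ n * D (R * z)) F := by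
    refine continuousOn_const.mul (hD.comp (by fun_prop) fun z hz => ?_)
    refine hregion z (by simpa using hz.1) ?_
    rintro rfl
    have := hz.2
    simp only [Set.mem_ofPred_eq, sub_self, norm_zero] at this
    linarith
  obtain ⟨M, hM⟩ := hFc.exists_bound_of_continuousOn hcont
  refine ⟨max (2 ^ n * |C|) ((|M| + |L| * ε₁ ^ (-β)) * 2 ^ γ), fun z hz => ?_⟩
  have hz1 : ‖z‖ < 1 := by simpa using hz
  have hzne : z ≠ 1 := by
    rintro rfl
    simp at hz1
  have hpos : 0 < ‖1 - z‖ := norm_pos_iff.2 (sub_ne_zero.2 hzne.symm)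
  have hle2 : ‖1 - z‖ ≤ 2 := (norm_sub_le _ _).trans (by rw [norm_one]; linarith)
  rcases lt_or_ge ‖1 - z‖ ε₁ with hnear | hfar
  · have h1 : ‖1 - z‖ < ε / R := hnear.trans_le (min_le_left _ _)
    have h2 : ‖1 - z‖ < 1 / 2 := hnear.trans_le (min_le_right _ _)
    have h3 := hball (show (R : ℂ) * z ∈ Metric.ball (R : ℂ) ε ∩ leftRegion ρ R from ⟨by
      rw [Metric.mem_ball, dist_eq_norm, ← norm_neg]
      have : -((R : ℂ) * z - R) = R * (1 - z) := by ring
      rw [this, norm_mul, Complex.norm_real, Real.norm_of_nonneg hR.le]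
      rw [lt_div_iff₀ hR] at h1
      linarith, hregion z hz1.le hzne⟩)
    simp only [Set.mem_ofPred_eq, mul_div_cancel_left₀ _ hRC] at h3
    have h4 : ((R : ℂ) * z) ^ n * D (R * z) - z ^ n * (L * (1 - z) ^ ((-β : ℝ) : ℂ))
        = z ^ n * ((R : ℂ) ^ n * D (R * z) - L * (1 - z) ^ ((-β : ℝ) : ℂ)) := by
      rw [mul_pow]; ring
    rw [h4, norm_mul, norm_pow, Real.norm_of_nonneg (by positivity)] at h3
    have h5 : (1 / 2 : ℝ) ^ n ≤ ‖z‖ ^ n := by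
      refine pow_le_pow_left₀ (by norm_num) ?_ n
      have := norm_sub_norm_le (1 : ℂ) z
      rw [norm_one] at this
      linarith
    have h6 : ‖1 - z‖ ^ e ≤ ‖1 - z‖ ^ (-γ) :=
      Real.rpow_le_rpow_of_exponent_ge hpos (by linarith) he
    set X := ‖(R : ℂ) ^ n * D (R * z) - L * (1 - z) ^ ((-β : ℝ) : ℂ)‖ with hX
    have h7 : (1 / 2 : ℝ) ^ n * X ≤ |C| * ‖1 - z‖ ^ (-γ) :=
      calc (1 / 2 : ℝ) ^ n * X ≤ ‖z‖ ^ n * X := mul_le_mul_of_nonneg_right h5 (norm_nonneg _)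
        _ ≤ C * ‖1 - z‖ ^ e := h3
        _ ≤ |C| * ‖1 - z‖ ^ e := mul_le_mul_of_nonneg_right (le_abs_self C) (by positivity)
        _ ≤ |C| * ‖1 - z‖ ^ (-γ) := mul_le_mul_of_nonneg_left h6 (abs_nonneg C)
    have h8 : (2 : ℝ) ^ n * (1 / 2) ^ n = 1 := by rw [← mul_pow]; norm_num
    calc X = 2 ^ n * ((1 / 2 : ℝ) ^ n * X) := by rw [← mul_assoc, h8, one_mul]
      _ ≤ 2 ^ n * (|C| * ‖1 - z‖ ^ (-γ)) := mul_le_mul_of_nonneg_left h7 (by positivity)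
      _ = 2 ^ n * |C| * ‖1 - z‖ ^ (-γ) := by ring
      _ ≤ _ := mul_le_mul_of_nonneg_right (le_max_left _ _) (by positivity)
  · have h1 := hM z ⟨by simpa using hz1.le, hfar⟩
    have h2 : ‖(L : ℂ) * (1 - z) ^ ((-β : ℝ) : ℂ)‖ ≤ |L| * ε₁ ^ (-β) := by
      rw [norm_mul, Complex.norm_real, Real.norm_eq_abs, Complex.norm_cpow_real]
      exact mul_le_mul_of_nonneg_left
        (Real.rpow_le_rpow_of_nonpos hε₁0 hfar (by linarith)) (abs_nonneg L)
    have h3 : 1 ≤ (2 : ℝ) ^ γ * ‖1 - z‖ ^ (-γ) := by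
      have h4 := Real.rpow_le_rpow_of_nonpos hpos hle2 (show -γ ≤ 0 by linarith)
      have h5 : (2 : ℝ) ^ γ * 2 ^ (-γ) = 1 := by
        rw [← Real.rpow_add two_pos, add_neg_cancel, Real.rpow_zero]
      rw [← h5]
      exact mul_le_mul_of_nonneg_left h4 (by positivity)
    calc _ ≤ _ := norm_sub_le _ _
      _ ≤ |M| + |L| * ε₁ ^ (-β) := add_le_add (h1.trans (le_abs_self M)) h2
      _ ≤ (|M| + |L| * ε₁ ^ (-β)) * ((2 : ℝ) ^ γ * ‖1 - z‖ ^ (-γ)) :=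
        le_mul_of_one_le_right (by positivity) h3
      _ = (|M| + |L| * ε₁ ^ (-β)) * (2 : ℝ) ^ γ * ‖1 - z‖ ^ (-γ) := by ring
      _ ≤ _ := mul_le_mul_of_nonneg_right (le_max_right _ _) (by positivity)

/-- The coefficients of `g_κ` have the asymptotics predicted by its singular expansion. -/
theorem tendsto_coeff_of_singularExpansion {κ : ℕ → ℝ} {R η φ : ℝ} (hR : 0 < R) (hη : 0 < η)
    (hφ : φ ∈ Set.Ioo 0 (Real.pi / 2)) {g : ℂ → ℂ} (hg : IsGenFunOn κ g (Delta0 R η φ))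
    {s : ℝ} {gR : ℕ → ℝ} {a : ℝ} {δ : ℕ → ℝ} (hδ : ∀ n : ℕ, 0 < δ n)
    (hexp : ∀ n : ℕ,
      (fun z : ℂ => modDeriv n g z - singularExpansion R s a gR n z)
        =O[𝓝[Delta0 R η φ] (R : ℂ)] fun z : ℂ => ‖1 - z / (R : ℂ)‖ ^ (s - n + δ n)) :
    Tendsto (fun j : ℕ => κ j / j * R ^ j * (j : ℝ) ^ (s + 1)) atTop
      (𝓝 (a / Real.Gamma (-s))) := by
  set ρ := ‖(R : ℂ) * (1 + η * Complex.exp (Complex.I * φ))‖ with hρdef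
  have hρ : R < ρ := lt_norm_radius hR hη hφ
  have hsub : leftRegion ρ R ⊆ Delta0 R η φ := leftRegion_subset_Delta0 hφ
  -- With n ≥ ⌈s⌉ the polynomial part of the expansion is empty; the extra 3 gives β ≥ 3, and d ≤
  -- 1/2 then keeps γ = β - d above 2.
  set n := ⌈s⌉₊ + 3 with hn
  have hsn : s + 3 ≤ n := by
    rw [hn]
    push_cast
    linarith [Nat.le_ceil s]
  set β : ℝ := n - s with hβ
  set d := min (δ n) (1 / 2) with hd
  have hd0 : 0 < d := lt_min (hδ n) (by norm_num)
  have hd1 : d ≤ 1 / 2 := min_le_right _ _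
  have hd2 : d ≤ δ n := min_le_left _ _
  set L := Real.Gamma β * a / Real.Gamma (-s) with hL
  have hana : AnalyticOnNhd ℂ g (leftRegion ρ R) :=
    (hg.2.mono hsub).analyticOnNhd (isOpen_leftRegion ρ R)
  have hanan : AnalyticOnNhd ℂ (iteratedDeriv n g) (leftRegion ρ R) := by
    rw [iteratedDeriv_eq_iterate]
    exact hana.iterated_deriv n
  obtain ⟨K, hK⟩ := exists_norm_sub_le_rpow (D := iteratedDeriv n g) (ρ := ρ) (L := L)
    (β := β) (γ := β - d) (e := s - n + δ n) n hR hρ (by linarith) (by linarith)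
    (by linarith) hanan.continuousOn (by
      refine ((hexp n).mono (nhdsWithin_mono _ hsub)).congr_left fun z => ?_
      have h1 : Finset.Ico n ⌈s⌉₊ = ∅ := Finset.Ico_eq_empty (by omega)
      rw [modDeriv, singularExpansion, h1, Finset.sum_empty, zero_add, hL, hβ, neg_sub])
  have hmaps : ∀ z ∈ Metric.ball (0 : ℂ) 1, (R : ℂ) * z ∈ leftRegion ρ R := by
    intro z hz
    have hz1 : ‖z‖ < 1 := by simpa using hz
    have h1 : ‖(R : ℂ) * z‖ < R := by
      rw [norm_mul, Complex.norm_real, Real.norm_of_nonneg hR.le]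
      exact mul_lt_of_lt_one_right hR hz1
    exact ⟨h1.trans hρ, (Complex.re_le_norm _).trans_lt h1⟩
  have hdiff : DifferentiableOn ℂ (fun z : ℂ => (R : ℂ) ^ n * iteratedDeriv n g (R * z))
      (Metric.ball 0 1) :=
    (hanan.differentiableOn.comp (by fun_prop) hmaps).const_mul _
  refine tendsto_of_tendsto_shift n ?_
  have hlim := tendsto_coeff_mul_rpow (c := fun m => ((m + n).factorial : ℝ) / m.factorial
    * (κ (m + n) / ((m + n : ℕ) : ℝ) * R ^ (m + n))) (by linarith) (by linarith)
    (show β - d < β by linarith) hdiff (fun m => by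
      rw [iteratedDeriv_const_mul_field, iteratedDeriv_comp_mul_left, iteratedDeriv_iteratedDeriv,
        mul_zero, hg.iteratedDeriv_zero]
      have : (m.factorial : ℂ) ≠ 0 := by exact_mod_cast m.factorial_ne_zero
      push_cast
      field_simp
      ring) hK
  have hΓ : Real.Gamma β ≠ 0 := (Real.Gamma_pos_of_pos (by linarith)).ne'
  have hLim : L / Real.Gamma β = a / Real.Gamma (-s) := by
    rw [hL]
    field_simp
  rwa [hLim] at hlim

/-- Abel's limit theorem: inside the disk z g'(z) is ∑ κ_j z^j, so its radial limit is the sum of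
the series at R, already known to converge. -/
theorem hasSum_of_tendsto_modDeriv {κ : ℕ → ℝ} {R η φ : ℝ} (hR : 0 < R) (hη : 0 < η)
    (hφ : φ ∈ Set.Ioo 0 (Real.pi / 2)) {g : ℂ → ℂ} (hg : IsGenFunOn κ g (Delta0 R η φ)) {μ : ℝ}
    (hμ : Tendsto (fun r : ℝ => (modDeriv 1 g (r : ℂ)).re) (𝓝[<] R) (𝓝 μ))
    (hsum : Summable fun j : ℕ => (j : ℝ) * (κ j / j * R ^ j)) :
    HasSum (fun j : ℕ => (j : ℝ) * (κ j / j * R ^ j)) μ := by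
  have hρ := lt_norm_radius hR hη hφ
  have hball : Metric.ball (0 : ℂ) R ⊆ Delta0 R η φ := fun z hz => by
    rw [mem_ball_zero_iff] at hz
    exact leftRegion_subset_Delta0 hφ ⟨hz.trans hρ, (Complex.re_le_norm z).trans_lt hz⟩
  have hd : DifferentiableOn ℂ (deriv g) (Metric.ball 0 R) :=
    (hg.2.mono hball).deriv Metric.isOpen_ball
  set c : ℕ → ℝ := fun j => (j : ℝ) * (κ j / j * R ^ j) with hc
  have hval : ∀ r : ℝ, 0 < r → r < R → (modDeriv 1 g (r : ℂ)).re = ∑' j, c j * (r / R) ^ j := by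
    intro r hr0 hr
    have hmem : (r : ℂ) ∈ Metric.ball (0 : ℂ) R := by
      rw [mem_ball_zero_iff, Complex.norm_real, Real.norm_of_nonneg hr0.le]
      exact hr
    have h1 := (Complex.hasSum_taylorSeries_on_ball hd hmem).mul_left (r : ℂ)
    have h2 : ∀ m : ℕ, (r : ℂ) * ((m.factorial : ℂ)⁻¹ • ((r : ℂ) - 0) ^ m •
        iteratedDeriv m (deriv g) 0) = ((c (m + 1) * (r / R) ^ (m + 1) : ℝ) : ℂ) := by
      intro m
      rw [← iteratedDeriv_succ', hg.iteratedDeriv_zero, Nat.factorial_succ]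
      have h3 : (m.factorial : ℂ) ≠ 0 := by exact_mod_cast m.factorial_ne_zero
      have h4 : (R : ℂ) ≠ 0 := by exact_mod_cast hR.ne'
      have h5 : (m : ℂ) + 1 ≠ 0 := by exact_mod_cast m.succ_ne_zero
      simp only [hc, smul_eq_mul, sub_zero]
      push_cast
      rw [div_pow]
      field_simp
      ring
    simp only [h2] at h1
    have h6 := Complex.hasSum_re h1
    simp only [Complex.ofReal_re] at h6
    have h7 := (hasSum_nat_add_iff' (f := fun j => c j * (r / R) ^ j)
      (g := (modDeriv 1 g (r : ℂ)).re) 1).1 (by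
        simpa [hc, modDeriv, iteratedDeriv_one] using h6)
    exact h7.tsum_eq.symm
  have hab := Real.tendsto_tsum_powerSeries_nhdsWithin_lt hsum.hasSum.tendsto_sum_nat
  have hdiv : Tendsto (fun r : ℝ => r / R) (𝓝[<] R) (𝓝[<] 1) := by
    refine tendsto_nhdsWithin_iff.2 ⟨?_, ?_⟩
    · have : Tendsto (fun r : ℝ => r / R) (𝓝 R) (𝓝 (R / R)) := tendsto_id.div_const R
      rw [div_self hR.ne'] at this
      exact this.mono_left nhdsWithin_le_nhds
    · filter_upwards [self_mem_nhdsWithin] with r hr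
      exact (div_lt_one hR).2 hr
  have hlim := hab.comp hdiv
  have heq : ∑' j, c j = μ := by
    refine tendsto_nhds_unique (hlim.congr' ?_) hμ
    filter_upwards [Ioo_mem_nhdsLT hR] with r hr
    exact (hval r hr.1 hr.2).symm
  rw [← heq]
  exact hsum.hasSum

/-- Regularity at R makes g analytic on the whole closed disk, hence by compactness on a larger one,
so the rescaled coefficients decay geometrically. -/
theorem tendsto_coeff_of_analyticAt {θ : ℕ → ℝ} {R η φ : ℝ} (hR : 0 < R) (hη : 0 < η)
    (hφ : φ ∈ Set.Ioo 0 (Real.pi / 2)) {g : ℂ → ℂ} (hg : IsGenFunOn θ g (Delta0 R η φ))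
    (hreg : AnalyticAt ℂ g (R : ℂ)) (e : ℝ) :
    Tendsto (fun j : ℕ => θ j / j * R ^ j * (j : ℝ) ^ e) atTop (𝓝 0) := by
  have hρ := lt_norm_radius hR hη hφ
  have hsub := leftRegion_subset_Delta0 (R := R) (η := η) hφ
  set ρ := ‖(R : ℂ) * (1 + η * Complex.exp (Complex.I * φ))‖ with hρdef
  set V := {z : ℂ | AnalyticAt ℂ g z} with hV
  have hVo : IsOpen V := isOpen_analyticAt ℂ g
  have hclosed : Metric.closedBall (0 : ℂ) R ⊆ V := fun z hz => by
    rw [mem_closedBall_zero_iff] at hz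
    by_cases hzR : z = R
    · rw [hzR]
      exact hreg
    · exact (hg.2.mono hsub).analyticAt
        ((isOpen_leftRegion ρ R).mem_nhds (mem_leftRegion_of_norm_le hρ hz hzR))
  obtain ⟨ε, hε, hthick⟩ := (isCompact_closedBall (0 : ℂ) R).exists_thickening_subset_open
    hVo hclosed
  rw [thickening_closedBall hε hR.le] at hthick
  have hd : DifferentiableOn ℂ g (Metric.ball 0 (ε + R)) := fun z hz =>
    (hthick hz).differentiableAt.differentiableWithinAt
  set r := R + ε / 2 with hr
  have hr0 : 0 < r := by positivity
  have hmem : (r : ℂ) ∈ Metric.ball (0 : ℂ) (ε + R) := by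
    rw [mem_ball_zero_iff, Complex.norm_real, Real.norm_of_nonneg hr0.le]
    linarith
  have h1 := (Complex.hasSum_taylorSeries_on_ball hd hmem).summable.tendsto_atTop_zero
  have h2 : ∀ m : ℕ, (m.factorial : ℂ)⁻¹ • ((r : ℂ) - 0) ^ m • iteratedDeriv m g 0
      = ((θ m / m * r ^ m : ℝ) : ℂ) := by
    intro m
    rw [hg.iteratedDeriv_zero]
    have h3 : (m.factorial : ℂ) ≠ 0 := by exact_mod_cast m.factorial_ne_zero
    simp only [smul_eq_mul, sub_zero]
    push_cast
    field_simp
  simp only [h2] at h1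
  have h3 : Tendsto (fun m : ℕ => θ m / m * r ^ m) atTop (𝓝 0) := by
    have h7 := (Complex.continuous_re.tendsto 0).comp h1
    simp only [Function.comp_def, Complex.ofReal_re, Complex.zero_re] at h7
    exact h7
  have h4 : |R / r| < 1 := by
    rw [abs_of_pos (by positivity), div_lt_one hr0]
    linarith
  have h5 : Tendsto (fun m : ℕ => (m : ℝ) ^ e * (R / r) ^ m) atTop (𝓝 0) := by
    have h6 := tendsto_pow_const_mul_const_pow_of_abs_lt_one ⌈e⌉₊ h4
    refine squeeze_zero' (Eventually.of_forall fun m => by positivity) ?_ h6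
    filter_upwards [eventually_ge_atTop 1] with m hm
    refine mul_le_mul_of_nonneg_right ?_ (by positivity)
    rw [← Real.rpow_natCast]
    exact Real.rpow_le_rpow_of_exponent_le (by exact_mod_cast hm) (Nat.le_ceil e)
  have h6 := h3.mul h5
  rw [mul_zero] at h6
  refine h6.congr fun m => ?_
  rw [div_pow]
  field_simp

/-- The intensities of the surrogate-spatial measure in the supercritical regime. -/
theorem heavyTailed_of_singularExpansion {θ κ : ℕ → ℝ} (hθ : ∀ j : ℕ, 1 ≤ j → 0 ≤ θ j)
    (hκ : ∀ j : ℕ, 1 ≤ j → 0 ≤ κ j) {R η φ : ℝ} (hR : 0 < R) (hη : 0 < η)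
    (hφ : φ ∈ Set.Ioo 0 (Real.pi / 2)) {gκ gθ : ℂ → ℂ}
    (hgκ : IsGenFunOn κ gκ (Delta0 R η φ)) (hgθ : IsGenFunOn θ gθ (Delta0 R η φ))
    (hgθ_reg : AnalyticAt ℂ gθ (R : ℂ)) {s : ℝ} (hs : 1 < s) (hs_int : ∀ k : ℕ, s ≠ k)
    {gR : ℕ → ℝ} (hfin : Tendsto (fun r : ℝ => (modDeriv 1 gκ (r : ℂ)).re) (𝓝[<] R) (𝓝 (gR 1)))
    (hsuper : gR 1 < 1) {a : ℝ} (ha : a ≠ 0) {δ : ℕ → ℝ} (hδ : ∀ n : ℕ, 0 < δ n)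
    (hexp : ∀ n : ℕ,
      (fun z : ℂ => modDeriv n gκ z - singularExpansion R s a gR n z)
        =O[𝓝[Delta0 R η φ] (R : ℂ)] fun z : ℂ => ‖1 - z / (R : ℂ)‖ ^ (s - n + δ n)) :
    HeavyTailed (fun j => κ j / j * R ^ j) (fun j => θ j / j * R ^ j) s
      (a / Real.Gamma (-s)) (gR 1) := by
  have hp := tendsto_coeff_of_singularExpansion hR hη hφ hgκ hδ hexp
  have hnn : ∀ c : ℕ → ℝ, (∀ j : ℕ, 1 ≤ j → 0 ≤ c j) → ∀ j : ℕ, 0 ≤ c j / j * R ^ j := by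
    intro c hc j
    rcases Nat.eq_zero_or_pos j with rfl | hj
    · simp
    · have := hc j hj
      positivity
  -- The sign of a is not prescribed: the constant is nonnegative as a limit of nonnegative terms,
  -- and nonzero because Γ(-s) ≠ 0 for non-integer s.
  have hA : 0 ≤ a / Real.Gamma (-s) := ge_of_tendsto hp
    (Eventually.of_forall fun j => mul_nonneg (hnn κ hκ j) (by positivity))
  have hΓ : Real.Gamma (-s) ≠ 0 := Real.Gamma_ne_zero fun m h => hs_int m (neg_injective h)
  have hsum : Summable fun j : ℕ => (j : ℝ) * (κ j / j * R ^ j) := by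
    simpa using summable_rpow_mul_of_tendsto hp hs
  exact
    { p_nonneg := hnn κ hκ
      q_nonneg := hnn θ hθ
      one_lt := hs
      pos := lt_of_le_of_ne hA (div_ne_zero ha hΓ).symm
      tendsto_p := hp
      tendsto_q := tendsto_coeff_of_analyticAt hR hη hφ hgθ hgθ_reg (s + 1)
      mean := hasSum_of_tendsto_modDeriv hR hη hφ hgκ hfin hsum
      lt_one := hsuper }

/-! ## Expectations under the surrogate-spatial measure -/

theorem weight_nonneg {θ κ : ℕ → ℝ} (hθ : ∀ j : ℕ, 1 ≤ j → 0 ≤ θ j)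
    (hκ : ∀ j : ℕ, 1 ≤ j → 0 ≤ κ j) (N : ℕ) (σ : Equiv.Perm (Fin N)) : 0 ≤ weight θ κ N σ := by
  refine Finset.prod_nonneg fun j hj => pow_nonneg ?_ _
  have h1 := (Finset.mem_Icc.1 hj).1
  have := hθ j h1
  have := hκ j h1
  positivity

theorem pointProb_nonneg {θ κ : ℕ → ℝ} (hθ : ∀ j : ℕ, 1 ≤ j → 0 ≤ θ j)
    (hκ : ∀ j : ℕ, 1 ≤ j → 0 ≤ κ j) {N : ℕ} (hN : 0 < normConst θ κ N)
    (σ : Equiv.Perm (Fin N)) : 0 ≤ pointProb θ κ N σ :=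
  mul_nonneg (by positivity) (weight_nonneg hθ hκ N σ)

theorem expect_mono {θ κ : ℕ → ℝ} (hθ : ∀ j : ℕ, 1 ≤ j → 0 ≤ θ j)
    (hκ : ∀ j : ℕ, 1 ≤ j → 0 ≤ κ j) {N : ℕ} (hN : 0 < normConst θ κ N)
    {F G : Equiv.Perm (Fin N) → ℝ} (h : ∀ σ, F σ ≤ G σ) : expect θ κ N F ≤ expect θ κ N G :=
  Finset.sum_le_sum fun σ _ => mul_le_mul_of_nonneg_left (h σ) (pointProb_nonneg hθ hκ hN σ)

theorem expect_const {θ κ : ℕ → ℝ} {N : ℕ} (hN : 0 < normConst θ κ N) (c : ℝ) :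
    expect θ κ N (fun _ => c) = c := by
  have h1 : ∑ σ : Equiv.Perm (Fin N), weight θ κ N σ = N.factorial * normConst θ κ N := by
    rw [normConst]
    field_simp
  simp only [expect, pointProb]
  rw [← Finset.sum_mul, ← Finset.mul_sum, h1]
  field_simp

theorem expect_sub (θ κ : ℕ → ℝ) (N : ℕ) (F G : Equiv.Perm (Fin N) → ℝ) :
    expect θ κ N (fun σ => F σ - G σ) = expect θ κ N F - expect θ κ N G := by
  simp only [expect, mul_sub, Finset.sum_sub_distrib]

theorem expect_const_mul (θ κ : ℕ → ℝ) (N : ℕ) (c : ℝ) (F : Equiv.Perm (Fin N) → ℝ) :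
    expect θ κ N (fun σ => c * F σ) = c * expect θ κ N F := by
  simp only [expect, Finset.mul_sum]
  exact Finset.sum_congr rfl fun σ _ => by ring

theorem abs_expect_sub_le {θ κ : ℕ → ℝ} (hθ : ∀ j : ℕ, 1 ≤ j → 0 ≤ θ j)
    (hκ : ∀ j : ℕ, 1 ≤ j → 0 ≤ κ j) {N : ℕ} (hN : 0 < normConst θ κ N)
    {F G : Equiv.Perm (Fin N) → ℝ} {c : ℝ} (h : ∀ σ, |F σ - c| ≤ G σ) :
    |expect θ κ N F - c| ≤ expect θ κ N G := by
  have h1 := expect_mono hθ hκ hN fun σ => (abs_le.1 (h σ)).2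
  have h2 := expect_mono hθ hκ hN (F := fun σ => (-1) * G σ) (G := fun σ => F σ - c) fun σ => by
    have := (abs_le.1 (h σ)).1
    linarith
  rw [expect_sub, expect_const hN] at h1 h2
  rw [expect_const_mul] at h2
  exact abs_le.2 ⟨by linarith, h1⟩

theorem prob_eq_expect (θ κ : ℕ → ℝ) (N : ℕ) (A : Set (Equiv.Perm (Fin N))) :
    prob θ κ N A = expect θ κ N (A.indicator fun _ => 1) := by
  classical
  refine Finset.sum_congr rfl fun σ _ => ?_
  simp only [Set.indicator_apply]
  split_ifs <;> simp

/-! ### The giant cycle -/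

theorem sort_getD_of_unique_large {t : Multiset ℕ} {j B : ℕ} (hj : j ∈ t) (hjB : B ≤ j)
    (hB : 1 ≤ B) (h : ∀ i ∈ t.erase j, i < B) :
    (t.sort (· ≥ ·)).getD 0 0 = j ∧ ∀ k, 1 ≤ k → (t.sort (· ≥ ·)).getD k 0 < B := by
  have h1 : t.sort (· ≥ ·) = j :: (t.erase j).sort (· ≥ ·) := by
    conv_lhs => rw [← Multiset.cons_erase hj]
    exact Multiset.sort_cons _ _ (· ≥ ·) fun b hb => (h b hb).le.trans hjB
  rw [h1]
  refine ⟨rfl, fun k hk => ?_⟩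
  obtain ⟨k, rfl⟩ := Nat.exists_eq_succ_of_ne_zero (show k ≠ 0 by omega)
  rw [Nat.succ_eq_add_one, List.getD_cons_succ]
  rcases lt_or_ge k ((t.erase j).sort (· ≥ ·)).length with hk' | hk'
  · rw [List.getD_eq_getElem _ _ hk']
    exact h _ ((Multiset.mem_sort _).1 (List.getElem_mem hk'))
  -- Missing cycles have length 0, which is below B since B ≥ 1.
  · rw [List.getD_eq_default _ _ hk']
    omega

/-- The permutations with one cycle of length close to `ν N`, all others being shorter
than `b N`. -/
def giantCycleEvent (ν b δ : ℝ) (N : ℕ) : Set (Equiv.Perm (Fin N)) :=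
  {σ | |(longestCycle σ 0 : ℝ) - ν * N| ≤ δ * N ∧
    ∀ k, 1 ≤ k → (longestCycle σ k : ℝ) ≤ b * N}

theorem eventually_le_expect_giantCycleEvent {θ κ : ℕ → ℝ} {R s A μ : ℝ} (hR : 0 < R)
    (h : HeavyTailed (fun j => κ j / j * R ^ j) (fun j => θ j / j * R ^ j) s A μ)
    {b δ ε : ℝ} (hb : 0 < b) (hbν : b < 1 - μ) (hb1 : b ≤ 1) (hδ : 0 < δ) (hε : 0 < ε) :
    ∀ᶠ N : ℕ in atTop,
      1 - ε ≤ expect θ κ N ((giantCycleEvent (1 - μ) b δ N).indicator fun _ => 1) := by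
  classical
  filter_upwards [h.eventually_le_sum_window_div hb hbν hb1 hδ hε, h.eventually_partSum_pos,
    eventually_ge_atTop 1] with N h1 h2 hN
  refine h1.trans ?_
  obtain ⟨hB, -⟩ := HeavyTailed.ceil_mul_bounds hb hb1 hN
  set B := ⌈b * (N : ℝ)⌉₊ with hBdef
  set G : Multiset ℕ → ℝ := fun t =>
    if |(((t.sort (· ≥ ·)).getD 0 0 : ℕ) : ℝ) - (1 - μ) * N| ≤ δ * N ∧
      ∀ k, 1 ≤ k → (((t.sort (· ≥ ·)).getD k 0 : ℕ) : ℝ) ≤ b * N then 1 else 0 with hG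
  have h3 : ((giantCycleEvent (1 - μ) b δ N).indicator fun _ => (1 : ℝ))
      = fun σ => G σ.partition.parts := by
    funext σ
    simp only [Set.indicator_apply, giantCycleEvent, Set.mem_ofPred_eq, hG, longestCycle]
  rw [h3, expect_eq θ κ hR]
  refine div_le_div_of_nonneg_right (sum_mul_partSum_trunc_le (h.intensity_nonneg N) hB
    (Finset.filter_subset _ _) G (fun t => ?_) fun p j hj hjp hjB => ?_) h2.le
  · simp only [hG]
    split_ifs <;> norm_num
  · obtain ⟨hj1, hj2⟩ := Finset.mem_filter.1 hj
    obtain ⟨h4, h5⟩ := sort_getD_of_unique_large hjp (Finset.mem_Icc.1 hj1).1 hB hjB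
    simp only [hG]
    rw [if_pos]
    refine ⟨by rw [h4]; exact hj2, fun k hk => (Nat.lt_ceil.1 (h5 k hk)).le⟩

/-! ### The expected mass in long cycles -/

theorem expect_large_cycles (θ κ : ℕ → ℝ) {R : ℝ} (hR : 0 < R) {K N : ℕ} (hKN : K ≤ N)
    (hN : 0 < partSum (cycleIntensity θ κ R N) N) :
    expect θ κ N (fun σ => ∑ j ∈ Finset.Ioc K N, (j : ℝ) * (cycleCount σ j : ℝ))
      = N - ∑ j ∈ Finset.Icc 1 K, j * cycleIntensity θ κ R N j
          * (partSum (cycleIntensity θ κ R N) (N - j) / partSum (cycleIntensity θ κ R N) N) := by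
  have h1 := expect_eq θ κ hR N fun t => ∑ j ∈ Finset.Ioc K N, (j : ℝ) * t.count j
  simp only [cycleCount]
  rw [h1]
  set x := cycleIntensity θ κ R N with hx
  have h2 : ∑ p : N.Partition, (∑ j ∈ Finset.Ioc K N, (j : ℝ) * p.parts.count j)
      * partWeight x p.parts = ∑ j ∈ Finset.Ioc K N, j * x j * partSum x (N - j) := by
    simp only [Finset.sum_mul]
    rw [Finset.sum_comm]
    refine Finset.sum_congr rfl fun j hj => ?_
    rw [Finset.mem_Ioc] at hj
    rw [mul_assoc, ← sum_count_mul_partWeight_one x (by omega) hj.2, Finset.mul_sum]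
    exact Finset.sum_congr rfl fun _ _ => by ring
  have h3 : Finset.Icc 1 N = Finset.Icc 1 K ∪ Finset.Ioc K N := by
    ext j
    simp only [Finset.mem_union, Finset.mem_Icc, Finset.mem_Ioc]
    omega
  have h4 : Disjoint (Finset.Icc 1 K) (Finset.Ioc K N) := by
    rw [Finset.disjoint_left]
    intro j hj
    simp only [Finset.mem_Icc, Finset.mem_Ioc] at hj ⊢
    omega
  have h5 := natCast_mul_partSum x N
  rw [h3, Finset.sum_union h4] at h5
  have h6 : ∑ j ∈ Finset.Ioc K N, j * x j * partSum x (N - j)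
      = N * partSum x N - ∑ j ∈ Finset.Icc 1 K, j * x j * partSum x (N - j) := by linarith
  rw [h2, h6, sub_div, mul_div_cancel_right₀ _ hN.ne', Finset.sum_div]
  congr 1
  exact Finset.sum_congr rfl fun _ _ => by rw [mul_div_assoc]

/-- By the Mecke formula the expectation of j C_j is j x_j times a ratio of partition sums tending
to 1; after division by N the θ-part vanishes. The liminf is thus a limit. -/
theorem nuTildeK_eq {θ κ : ℕ → ℝ} {R s A μ : ℝ} (hR : 0 < R)
    (h : HeavyTailed (fun j => κ j / j * R ^ j) (fun j => θ j / j * R ^ j) s A μ) (K : ℕ) :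
    nuTildeK θ κ K = 1 - ∑ j ∈ Finset.Icc 1 K, (j : ℝ) * (κ j / j * R ^ j) := by
  refine Tendsto.liminf_eq ?_
  have h1 : ∀ j : ℕ, Tendsto (fun N : ℕ => (N : ℝ)⁻¹ * (j * cycleIntensity θ κ R N j
      * (partSum (cycleIntensity θ κ R N) (N - j) / partSum (cycleIntensity θ κ R N) N)))
      atTop (𝓝 ((j : ℝ) * (κ j / j * R ^ j))) := by
    intro j
    have h2 : Tendsto (fun N : ℕ => (j : ℝ) * ((θ j / j * R ^ j) * (N : ℝ)⁻¹ + κ j / j * R ^ j))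
        atTop (𝓝 ((j : ℝ) * (κ j / j * R ^ j))) := by
      simpa using (((tendsto_inv_atTop_zero.comp (tendsto_natCast_atTop_atTop (R := ℝ))).const_mul
        (θ j / j * R ^ j)).add_const (κ j / j * R ^ j)).const_mul (j : ℝ)
    have h3 := h2.mul (h.tendsto_partSum_ratio j)
    rw [mul_one] at h3
    refine h3.congr' ?_
    filter_upwards [eventually_ge_atTop 1] with N hN
    have hN0 : (N : ℝ) ≠ 0 := by positivity
    change _ * (partSum (cycleIntensity θ κ R N) (N - j) / partSum (cycleIntensity θ κ R N) N) = _
    rw [← mul_assoc]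
    congr 1
    rw [cycleIntensity]
    field_simp
  have h4 := (tendsto_finsetSum (Finset.Icc 1 K) fun j _ => h1 j).const_sub 1
  refine h4.congr' ?_
  filter_upwards [eventually_ge_atTop 1, eventually_ge_atTop K, h.eventually_partSum_pos]
    with N hN hKN hpos
  have hN0 : (N : ℝ) ≠ 0 := by positivity
  rw [expect_large_cycles θ κ hR hKN hpos, mul_sub, one_div, inv_mul_cancel₀ hN0, Finset.mul_sum]

theorem tendsto_nuTildeK {θ κ : ℕ → ℝ} {R s A μ : ℝ} (hR : 0 < R)
    (h : HeavyTailed (fun j => κ j / j * R ^ j) (fun j => θ j / j * R ^ j) s A μ) :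
    Tendsto (nuTildeK θ κ) atTop (𝓝 (1 - μ)) := by
  rw [funext (nuTildeK_eq hR h)]
  refine Tendsto.const_sub 1 ?_
  refine ((tendsto_add_atTop_iff_nat 1).2 h.mean.tendsto_sum_nat).congr fun K => ?_
  rw [Finset.range_eq_Ico, Finset.sum_eq_sum_Ico_succ_bot (Nat.succ_pos K)]
  simp only [Nat.cast_zero, zero_mul, zero_add]
  rfl

/-- On the giant cycle event the rescaled vector is within r of (1, 0, 0, …) in the sup norm, so
continuity of f applies; off the event the error is at most 2‖f‖, with vanishing probability. -/
theorem tendsto_expect_longestCycle {θ κ : ℕ → ℝ} (hθ : ∀ j : ℕ, 1 ≤ j → 0 ≤ θ j)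
    (hκ : ∀ j : ℕ, 1 ≤ j → 0 ≤ κ j) {R s A μ : ℝ} (hR : 0 < R)
    (h : HeavyTailed (fun j => κ j / j * R ^ j) (fun j => θ j / j * R ^ j) s A μ)
    (hnorm : ∀ᶠ N : ℕ in atTop, 0 < normConst θ κ N) (m : ℕ)
    (f : BoundedContinuousFunction (Fin m → ℝ) ℝ) :
    Tendsto (fun N : ℕ => expect θ κ N (fun σ =>
        f (fun i : Fin m => (longestCycle σ (i : ℕ) : ℝ) / (N * (1 - μ)))))
      atTop (𝓝 (f (fun i : Fin m => if (i : ℕ) = 0 then 1 else 0))) := by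
  classical
  have hν : 0 < 1 - μ := by linarith [h.lt_one]
  set ν := 1 - μ with hνdef
  set e : Fin m → ℝ := fun i => if (i : ℕ) = 0 then 1 else 0 with he
  rw [Metric.tendsto_nhds]
  intro ε hε
  obtain ⟨r, hr, hfr⟩ := Metric.continuous_iff.1 f.continuous e (ε / 2) (by linarith)
  -- After division by ν the tolerance c is below r, and c < ν leaves room for the bound on the
  -- shorter cycles.
  set c := min (r / 2) (1 / 2) * ν with hc
  have hr2 : 0 < min (r / 2) (1 / 2) := lt_min (by linarith) (by norm_num)
  have hc0 : 0 < c := by positivity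
  have hcr : c / ν < r := by
    rw [hc, mul_div_cancel_right₀ _ hν.ne']
    have := min_le_left (r / 2) (1 / 2)
    linarith
  have hcν : c < ν := by
    have := min_le_right (r / 2) (1 / 2)
    rw [hc]
    nlinarith
  set b := min c 1 with hb
  have hb0 : 0 < b := lt_min hc0 one_pos
  -- The exceptional probability ε / (4‖f‖ + 1), multiplied by 2‖f‖, stays below ε/2; the 1 covers f
  -- = 0.
  have hM : 0 < 4 * ‖f‖ + 1 := by positivity
  filter_upwards [hnorm, eventually_ge_atTop 1,
    eventually_le_expect_giantCycleEvent hR h hb0 ((min_le_left _ _).trans_lt hcν)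
      (min_le_right _ _) hc0 (show 0 < ε / (4 * ‖f‖ + 1) by positivity)] with N hpos hN hgood
  have hN0 : (0 : ℝ) < N := by exact_mod_cast hN
  rw [Real.dist_eq]
  set E := giantCycleEvent ν b c N
  have hpt : ∀ σ : Equiv.Perm (Fin N),
      |f (fun i : Fin m => (longestCycle σ (i : ℕ) : ℝ) / (N * ν)) - f e|
        ≤ (ε / 2 + 2 * ‖f‖) - 2 * ‖f‖ * E.indicator (fun _ => 1) σ := by
    intro σ
    by_cases hσ : σ ∈ E
    · rw [Set.indicator_of_mem hσ]
      have h1 : dist (fun i : Fin m => (longestCycle σ (i : ℕ) : ℝ) / (N * ν)) e < r := by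
        rw [dist_pi_lt_iff hr]
        intro i
        refine lt_of_le_of_lt ?_ hcr
        rw [Real.dist_eq, he]
        rw [le_div_iff₀ hν, ← mul_le_mul_iff_left₀ hN0]
        have h2 : ∀ y z : ℝ, |y / (N * ν) - z| * ν * N = |y - z * (ν * N)| := by
          intro y z
          have h3 : y - z * (ν * N) = (y / (N * ν) - z) * (ν * N) := by
            field_simp
          rw [h3, abs_mul, abs_of_pos (mul_pos hν hN0), mul_assoc]
        rw [h2]
        beta_reduce
        by_cases hi : (i : ℕ) = 0
        · rw [if_pos hi, hi, one_mul]
          exact hσ.1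
        · rw [if_neg hi, zero_mul, sub_zero, Nat.abs_cast]
          exact (hσ.2 i (by omega)).trans
            (mul_le_mul_of_nonneg_right (min_le_left _ _) hN0.le)
      have h2 := hfr _ h1
      rw [Real.dist_eq] at h2
      linarith
    · rw [Set.indicator_of_notMem hσ]
      have h1 := f.dist_le_two_norm (fun i : Fin m => (longestCycle σ (i : ℕ) : ℝ) / (N * ν)) e
      rw [Real.dist_eq] at h1
      linarith
  refine (abs_expect_sub_le hθ hκ hpos hpt).trans_lt ?_
  rw [expect_sub, expect_const hpos, expect_const_mul]
  have h1 : 2 * ‖f‖ * (1 - ε / (4 * ‖f‖ + 1))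
      ≤ 2 * ‖f‖ * expect θ κ N (E.indicator fun _ => 1) :=
    mul_le_mul_of_nonneg_left hgood (by positivity)
  have h2 : 2 * ‖f‖ * (ε / (4 * ‖f‖ + 1)) < ε / 2 := by
    rw [mul_div_assoc', div_lt_iff₀ hM]
    nlinarith
  linarith

theorem tendsto_prob_longestCycle {θ κ : ℕ → ℝ} (hθ : ∀ j : ℕ, 1 ≤ j → 0 ≤ θ j)
    (hκ : ∀ j : ℕ, 1 ≤ j → 0 ≤ κ j) {R s A μ : ℝ} (hR : 0 < R)
    (h : HeavyTailed (fun j => κ j / j * R ^ j) (fun j => θ j / j * R ^ j) s A μ)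
    (hnorm : ∀ᶠ N : ℕ in atTop, 0 < normConst θ κ N) {ε : ℝ} (hε : 0 < ε) :
    Tendsto (fun N : ℕ => prob θ κ N
        {σ | ε ≤ |(longestCycle σ 0 : ℝ) / (N * (1 - μ)) - 1|}) atTop (𝓝 0) := by
  classical
  have hν : 0 < 1 - μ := by linarith [h.lt_one]
  obtain ⟨b, hb, hbν, hb1⟩ := h.exists_pos_lt_window
  set ν := 1 - μ with hνdef
  rw [Metric.tendsto_nhds]
  intro ε' hε'
  filter_upwards [hnorm, eventually_ge_atTop 1,
    eventually_le_expect_giantCycleEvent hR h hb hbν hb1 (show 0 < ε * ν / 2 by positivity)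
      (half_pos hε')] with N hpos hN hgood
  have hN0 : (0 : ℝ) < N := by exact_mod_cast hN
  rw [Real.dist_eq, sub_zero, prob_eq_expect]
  set E := giantCycleEvent ν b (ε * ν / 2) N
  set F : Set (Equiv.Perm (Fin N)) := {σ | ε ≤ |(longestCycle σ 0 : ℝ) / (N * ν) - 1|}
  have hpt : ∀ σ : Equiv.Perm (Fin N),
      F.indicator (fun _ => (1 : ℝ)) σ ≤ 1 - E.indicator (fun _ => 1) σ := by
    intro σ
    by_cases hσ : σ ∈ E
    · rw [Set.indicator_of_mem hσ, Set.indicator_of_notMem, sub_self]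
      intro hF
      have h1 : ε ≤ |(longestCycle σ 0 : ℝ) / (N * ν) - 1| := hF
      have h2 := hσ.1
      have h3 : (longestCycle σ 0 : ℝ) - ν * N
          = ((longestCycle σ 0 : ℝ) / (N * ν) - 1) * (ν * N) := by field_simp
      have h4 : 0 < ν * N := mul_pos hν hN0
      rw [h3, abs_mul, abs_of_pos h4] at h2
      nlinarith [mul_le_mul_of_nonneg_right h1 h4.le, mul_pos hε h4]
    · rw [Set.indicator_of_notMem hσ, sub_zero]
      exact Set.indicator_le_self' (fun _ _ => zero_le_one) σ
  have h1 := expect_mono hθ hκ hpos hpt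
  rw [expect_sub, expect_const hpos] at h1
  have h2 : 0 ≤ expect θ κ N (F.indicator fun _ => 1) := by
    have := expect_mono hθ hκ hpos (F := fun _ => 0) (G := F.indicator fun _ => (1 : ℝ))
      fun σ => Set.indicator_nonneg (fun _ _ => zero_le_one) σ
    rwa [expect_const hpos] at this
  rw [abs_of_nonneg h2]
  linarith

end SurrogateSpatial

/-! ### The main theorem -/

theorem mainTheorem2
    (θ κ : ℕ → ℝ)
    (hθ : ∀ j : ℕ, 1 ≤ j → 0 ≤ θ j)
    (hκ : ∀ j : ℕ, 1 ≤ j → 0 ≤ κ j)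
    -- `κ` is non-arithmetic and non-degenerate
    (hκ_arith : ¬ ∃ j₀ : ℕ, 1 < j₀ ∧ ∀ j : ℕ, 1 ≤ j → κ j ≠ 0 → j₀ ∣ j)
    (hκ_nondeg : ∃ j : ℕ, 2 ≤ j ∧ 0 < κ j)
    -- the generating functions, holomorphic in `Δ₀`
    (R η φ : ℝ) (hR : 0 < R) (hη : 0 < η) (hφ : φ ∈ Set.Ioo 0 (Real.pi / 2))
    (gκ gθ : ℂ → ℂ)
    (hradius : (SurrogateSpatial.genSeries κ).radius = ENNReal.ofReal R)
    (hgκ : SurrogateSpatial.IsGenFunOn κ gκ (SurrogateSpatial.Delta0 R η φ))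
    (hgθ : SurrogateSpatial.IsGenFunOn θ gθ (SurrogateSpatial.Delta0 R η φ))
    -- `g_θ` is regular at `R`
    (hgθ_reg : AnalyticAt ℂ gθ (R : ℂ))
    -- the singular exponent of `g_κ`, and the boundary values `gR n = g_κ^{n}(R)`
    (s : ℝ) (hs : 1 < s) (hs_int : ∀ k : ℕ, s ≠ k)
    (gR : ℕ → ℝ)
    (hfin : ∀ n : ℕ, (n : ℝ) < s →
      Tendsto (fun r : ℝ => (SurrogateSpatial.modDeriv n gκ (r : ℂ)).re) (𝓝[<] R) (𝓝 (gR n)))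
    (hinf : ∀ n : ℕ, s < (n : ℝ) →
      Tendsto (fun r : ℝ => (SurrogateSpatial.modDeriv n gκ (r : ℂ)).re) (𝓝[<] R) atTop)
    -- supercriticality
    (hsuper : gR 1 < 1)
    -- the expansions of the modified derivatives of `g_κ` at `R`
    (a : ℝ) (ha : a ≠ 0) (δ : ℕ → ℝ) (hδ : ∀ n : ℕ, 0 < δ n)
    (hexp : ∀ n : ℕ,
      (fun z : ℂ => SurrogateSpatial.modDeriv n gκ z -
          SurrogateSpatial.singularExpansion R s a gR n z)
        =O[𝓝[SurrogateSpatial.Delta0 R η φ] (R : ℂ)]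
      (fun z : ℂ => ‖1 - z / (R : ℂ)‖ ^ (s - n + δ n))) :
    -- the measures are well defined for all large `N`
    (∀ᶠ N : ℕ in atTop, 0 < SurrogateSpatial.normConst θ κ N) ∧
    -- `ν̃` exists as a limit, and it is `1 - g_κ^{1}(R) > 0`
    Tendsto (SurrogateSpatial.nuTildeK θ κ) atTop (𝓝 (SurrogateSpatial.nuTilde θ κ)) ∧
    SurrogateSpatial.nuTilde θ κ = 1 - gR 1 ∧
    0 < SurrogateSpatial.nuTilde θ κ ∧
    -- weak convergence of the finite-dimensional distributions to `(1, 0, 0, …)`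
    (∀ (m : ℕ) (f : BoundedContinuousFunction (Fin m → ℝ) ℝ),
      Tendsto (fun N : ℕ => SurrogateSpatial.expect θ κ N (fun σ =>
          f (fun i : Fin m => (SurrogateSpatial.longestCycle σ (i : ℕ) : ℝ) /
            (N * SurrogateSpatial.nuTilde θ κ))))
        atTop (𝓝 (f (fun i : Fin m => if (i : ℕ) = 0 then 1 else 0)))) ∧
    -- law of large numbers for the longest cycle
    (∀ ε : ℝ, 0 < ε →
      Tendsto (fun N : ℕ => SurrogateSpatial.prob θ κ N
          {σ | ε ≤ |(SurrogateSpatial.longestCycle σ 0 : ℝ) /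
            (N * SurrogateSpatial.nuTilde θ κ) - 1|})
        atTop (𝓝 0)) := by
  have h := SurrogateSpatial.heavyTailed_of_singularExpansion hθ hκ hR hη hφ hgκ hgθ hgθ_reg hs
    hs_int (hfin 1 (by exact_mod_cast hs)) hsuper ha hδ hexp
  have hlim := SurrogateSpatial.tendsto_nuTildeK hR h
  -- `nuTilde` is a `limUnder`, so its value is known only once convergence is established.
  have hnu : SurrogateSpatial.nuTilde θ κ = 1 - gR 1 := hlim.limUnder_eq
  have hnorm : ∀ᶠ N : ℕ in atTop, 0 < SurrogateSpatial.normConst θ κ N := by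
    filter_upwards [h.eventually_partSum_pos] with N hN
    rw [SurrogateSpatial.normConst_eq θ κ hR]
    exact div_pos hN (by positivity)
  rw [hnu]
  exact ⟨hnorm, hlim, rfl, by linarith,
    SurrogateSpatial.tendsto_expect_longestCycle hθ hκ hR h hnorm,
    fun ε hε => SurrogateSpatial.tendsto_prob_longestCycle hθ hκ hR h hnorm hε⟩
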